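/- **Setting.** Let $\Sigma=\{1,\dots,d\}$, $T>0$, $0<\kappa\le M$, $A=[\kappa,M]^d$, and let $P(\Sigma)\subset\mathbb R^d$ be the simplex of probability vectors; $|\cdot|$ is the Euclidean norm. Let $F,G:\Sigma\times P(\Sigma)\to\mathbb R$ and $L:\Sigma\times A\to\mathbb R$, with $L$ continuous in the control, and assume that for all $x\in\Sigma$, $p\in\mathbb R^d$ the function $a\mapsto L(x,a)+a\cdot p$ has a unique minimizer $\alpha^*(x,p)$ in $A$. Put $H(x,p)=\sup_{a\in A}\{-a\cdot p-L(x,a)\}$. For $g:\Sigma\to\mathbb R$ let $\Delta g(x)=(g(y)-g(x))_{y\in\Sigma}$; for $g:\Sigma^N\to\mathbb R$ let $\Delta^jg(\boldsymbol x)\in\mathbb R^d$ be the same difference in the $j$-th coordinate. For $\boldsymbol x\in\Sigma^N$ let $m^N_{\boldsymbol x}=\frac1N\sum_j\delta_{x_j}$ and $m^{N,i}_{\boldsymbol x}=\frac1{N-1}\sum_{j\ne i}\delta_{x_j}$. For $\Phi:P(\Sigma)\to\mathbb R$, a function $D^m\Phi:P(\Sigma)\times\Sigma\to\mathbb R^d$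 is a derivative of $\Phi$ if $[D^m\Phi(m,y)]_z=\lim_{s\to0^+}\frac{\Phi(m+s(\delta_z-\delta_y))-\Phi(m)}{s}$ whenever the direction $\delta_z-\delta_y$ is admissible at $m$ (i.e. does not immediately leave the simplex). A function $U:[0,T]\times\Sigma\times P(\Sigma)\to\mathbb R$ is a *regular solution* of the Master Equation if it is continuous, $C^1$ in $t$, and has a derivative $D^mU(t,x,m,y)$ with respect to $m$ that is Lipschitz continuous in $m$ uniformly in $(t,x,y)$, such that for all $(t,x,m)$ $$-\partial_tU+H(x,\Delta^xU)-\sum_{y\in\Sigma}m_y\,D^mU(t,x,m,y)\cdot\alpha^*(y,\Delta^yU(t,y,m))=F(x,m),\qquad U(T,x,m)=G(x,m).$$ **Assumptions.** There is a regular solution $U$, and (H1) holds: $H(x,\cdot)$ and $\alpha^*(x,\cdot)$ are Lipschitz continuous on $\{|p|\le K\}$ for every $x\in\Sigma$, where $K$ is at least the a priori bound $2\sqrt d\,\big(T(\max_x|H(x,0)|+\sup|F|)+\sup|G|\big)$ for the finite differences of the value functions. For $N\ge2$ let $v^{N,i}:[0,T]\times\Sigma^N\to\mathbb R$, $i=1,\dots,N$,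 be the ($C^1$ in time) solution of $$-\partial_tv^{N,i}-\sum_{j\ne i}\alpha^*(x_j,\Delta^jv^{N,j})\cdot\Delta^jv^{N,i}+H(x_i,\Delta^iv^{N,i})=F(x_i,m^{N,i}_{\boldsymbol x}),\qquad v^{N,i}(T,\boldsymbol x)=G(x_i,m^{N,i}_{\boldsymbol x}),$$ and let $u^{N,i}(t,\boldsymbol x)=U(t,x_i,m^{N,i}_{\boldsymbol x})$. Let $\Xi=[0,M]^d$ and let $\nu$ be the sum of the one-dimensional Lebesgue measures on the $d$ coordinate axes intersected with $\Xi$. On a filtered probability space let $\mathcal N_1,\dots,\mathcal N_N$ be independent Poisson random measures on $[0,T]\times\Xi$ with intensity $dt\otimes\nu$, Poisson with respect to the filtration, and let $Z_1,\dots,Z_N$ be i.i.d. $\Sigma$-valued, $\mathcal F_0$-measurable (hence independent of the noise) with law $m_0\in P(\Sigma)$. Let $\boldsymbol Y$ and $\boldsymbol X$ be adapted càdlàg $\Sigma^N$-valued solutions on $[0,T]$ of $$Y_i(t)=Z_i+\int_0^t\!\!\int_\Xi\sum_{y\in\Sigma}(y-Y_i(s^-))\mathbf 1_{]0,\alpha^i_y(s,\boldsymbol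 Y_{s^-})[}(\xi_y)\,\mathcal N_i(ds,d\xi),$$ $$X_i(t)=Z_i+\int_0^t\!\!\int_\Xi\sum_{y\in\Sigma}(y-X_i(s^-))\mathbf 1_{]0,\tilde\alpha^i_y(s,\boldsymbol X_{s^-})[}(\xi_y)\,\mathcal N_i(ds,d\xi),$$ where $\alpha^i(t,\boldsymbol x)=\alpha^*(x_i,\Delta^iv^{N,i}(t,\boldsymbol x))$ and $\tilde\alpha^i(t,\boldsymbol x)=\alpha^*(x_i,\Delta^iu^{N,i}(t,\boldsymbol x))$. **Theorem.** There is a constant $C>0$, independent of $N$, $i$, $m_0$, of the probability space, the noise and the initial data, such that for every $N\ge2$ and every $i\in\{1,\dots,N\}$ $$\mathbb E\Big[\sup_{t\in[0,T]}|Y_i(t)-X_i(t)|\Big]\le\frac CN,\qquad \mathbb E\Big[\sup_{t\in[0,T]}|m^N_{\boldsymbol Y_t}-m^N_{\boldsymbol X_t}|\Big]\le\frac CN,$$ $$\mathbb E\Big[\sup_{t\in[0,T]}|u^{N,i}(t,\boldsymbol Y_t)-v^{N,i}(t,\boldsymbol Y_t)|^2+\int_0^T|\Delta^iu^{N,i}(t,\boldsymbol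 Y_t)-\Delta^iv^{N,i}(t,\boldsymbol Y_t)|^2dt\Big]\le\frac C{N^2},$$ $$\frac1N\sum_{i=1}^N|v^{N,i}(0,\boldsymbol Z)-u^{N,i}(0,\boldsymbol Z)|\le\frac CN\qquad\text{almost surely}.$$ -/

import Mathlib

open Set Filter Topology MeasureTheory ProbabilityTheory
open scoped NNReal ENNReal BigOperators

noncomputable section

namespace FiniteMFG

/-- `ℝ^d` with its Euclidean norm: costates, controls, marks and measures on the state space
`Fin d` (the states `1, …, d`) all live here. -/
abbrev Vec (d : ℕ) : Type := EuclideanSpace ℝ (Fin d)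

/-- The numerical value `1, …, d` of a state. -/
def label {d : ℕ} (x : Fin d) : ℝ := ((x : ℕ) : ℝ) + 1

/-- The Dirac mass at the state `x`. -/
def diracVec {d : ℕ} (x : Fin d) : Vec d := EuclideanSpace.single x (1 : ℝ)

/-- The simplex `P(Σ)` of probability vectors. -/
def simplex (d : ℕ) : Set (Vec d) := {m | (∀ x, 0 ≤ m x) ∧ ∑ x, m x = 1}

/-- The set `[κ, M]^d` of control values. -/
def controlSet (d : ℕ) (κ M : ℝ) : Set (Vec d) := {a | ∀ y, a y ∈ Icc κ M}

/-- The finite difference `Δ g (x) = (g y - g x)_y` of a function on the state space. -/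
def stateDiff {d : ℕ} (g : Fin d → ℝ) (x : Fin d) : Vec d :=
  WithLp.toLp 2 fun y => g y - g x

/-- The finite difference `Δ^j g (x)` of a function of `N` states with respect to the state of
the `j`-th player. -/
def playerDiff {d N : ℕ} (j : Fin N) (g : (Fin N → Fin d) → ℝ) (x : Fin N → Fin d) : Vec d :=
  WithLp.toLp 2 fun y => g (Function.update x j y) - g x

/-- The empirical measure of all players. -/
def empirical {d N : ℕ} (x : Fin N → Fin d) : Vec d :=
  (N : ℝ)⁻¹ • ∑ j, diracVec (x j)

/-- The empirical measure of all players except the `i`-th (meaningful for `N ≥ 2`). -/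
def empiricalExcept {d N : ℕ} (i : Fin N) (x : Fin N → Fin d) : Vec d :=
  ((N : ℝ) - 1)⁻¹ • ∑ j ∈ Finset.univ.erase i, diracVec (x j)

/-- `D` is a derivative of `U` on the simplex: `[D m y]_z` is the one-sided derivative of `U` at
`m` along `δ_z - δ_y`, the limit being taken across admissible directions only (the filter is
trivial if the direction leaves the simplex). -/
def HasSimplexDeriv {d : ℕ} (U : Vec d → ℝ) (D : Vec d → Fin d → Vec d) : Prop :=
  ∀ m ∈ simplex d, ∀ y z : Fin d,
    Tendsto (fun s : ℝ => (U (m + s • (diracVec z - diracVec y)) - U m) / s)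
      (𝓝[{s : ℝ | 0 < s ∧ m + s • (diracVec z - diracVec y) ∈ simplex d}] 0)
      (𝓝 (D m y z))

/-- The data of the game: horizon, bounds on the rates, Lagrangian, running and terminal cost.
The Lagrangian is continuous in the control and, for all `x` and `p`, `a ↦ L x a + a · p` has a
unique minimizer over the control set. -/
structure Game (d : ℕ) where
  T : ℝ
  κ : ℝ
  M : ℝ
  L : Fin d → Vec d → ℝ
  F : Fin d → Vec d → ℝ
  G : Fin d → Vec d → ℝ
  T_pos : 0 < T
  κ_pos : 0 < κ
  κ_le_M : κ ≤ M
  L_continuousOn : ∀ x, ContinuousOn (L x) (controlSet d κ M)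
  existsUnique_minimizer : ∀ (x : Fin d) (p : Vec d), ∃! a : Vec d,
    a ∈ controlSet d κ M ∧ IsMinOn (fun b => L x b + inner ℝ b p) (controlSet d κ M) a

namespace Game

variable {d : ℕ} (𝒢 : Game d)

/-- The set of control values of the game. -/
def controls : Set (Vec d) := controlSet d 𝒢.κ 𝒢.M

/-- The Hamiltonian `H(x, p) = sup_{a} (- a · p - L(x, a))`. -/
def H (x : Fin d) (p : Vec d) : ℝ :=
  sSup ((fun a => - inner ℝ a p - 𝒢.L x a) '' 𝒢.controls)

/-- The optimal control `α*(x, p)`, the unique minimizer of `a ↦ L(x, a) + a · p`. -/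
def αstar (x : Fin d) (p : Vec d) : Vec d :=
  (𝒢.existsUnique_minimizer x p).choose

/-- `H` and `α*` are Lipschitz continuous in `p` for `|p| ≤ K`. -/
def H1 (K : ℝ) : Prop :=
  ∀ x, ∃ C : ℝ≥0, LipschitzOnWith C (𝒢.H x) (Metric.closedBall 0 K) ∧
    LipschitzOnWith C (𝒢.αstar x) (Metric.closedBall 0 K)

/-- `K` is large enough for the a priori bound on the finite differences of the value functions
read off the data, `K ≥ 2 √d (T (sup |H(·, 0)| + sup |F|) + sup |G|)`.  Here
`H(x, 0) = - min_a L(x, a)`. -/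
def IsAprioriRadius (K : ℝ) : Prop :=
  ∃ cH cF cG : ℝ, (∀ x, |𝒢.H x 0| ≤ cH) ∧
    (∀ x, ∀ m ∈ simplex d, |𝒢.F x m| ≤ cF) ∧
    (∀ x, ∀ m ∈ simplex d, |𝒢.G x m| ≤ cG) ∧
    2 * Real.sqrt d * (𝒢.T * (cH + cF) + cG) ≤ K

/-- `U` is a classical solution of the Master Equation, with derivative `D` in the measure. -/
structure IsClassicalSolution (U : ℝ → Fin d → Vec d → ℝ)
    (D : ℝ → Fin d → Vec d → Fin d → Vec d) : Prop where
  continuousOn : ∀ x, ContinuousOn (fun q : ℝ × Vec d => U q.1 x q.2)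
    (Icc 0 𝒢.T ×ˢ simplex d)
  contDiffOn_time : ∀ x, ∀ m ∈ simplex d, ContDiffOn ℝ 1 (fun t => U t x m) (Icc 0 𝒢.T)
  hasSimplexDeriv : ∀ t ∈ Icc 0 𝒢.T, ∀ x, HasSimplexDeriv (U t x) (D t x)
  continuousOn_deriv : ∀ t ∈ Icc 0 𝒢.T, ∀ x y, ContinuousOn (fun m => D t x m y) (simplex d)
  equation : ∀ t ∈ Icc 0 𝒢.T, ∀ x, ∀ m ∈ simplex d,
    - derivWithin (fun s => U s x m) (Icc 0 𝒢.T) t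
      + 𝒢.H x (stateDiff (fun y => U t y m) x)
      - ∑ y, m y * inner ℝ (D t x m y) (𝒢.αstar y (stateDiff (fun z => U t z m) y))
      = 𝒢.F x m
  terminal : ∀ x, ∀ m ∈ simplex d, U 𝒢.T x m = 𝒢.G x m

/-- `U` is a regular solution of the Master Equation: a classical solution whose derivative in
the measure is Lipschitz continuous in the measure, uniformly in time and state. -/
def IsRegularSolution (U : ℝ → Fin d → Vec d → ℝ) : Prop :=
  ∃ D : ℝ → Fin d → Vec d → Fin d → Vec d, 𝒢.IsClassicalSolution U D ∧
    ∃ C : ℝ, ∀ t ∈ Icc 0 𝒢.T, ∀ x y, ∀ m ∈ simplex d, ∀ m' ∈ simplex d,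
      ‖D t x m y - D t x m' y‖ ≤ C * ‖m - m'‖

/-- `v i t x`, `i : Fin N`, is a classical solution of the Hamilton-Jacobi-Bellman system of the
`N`-player game with the mean field costs `F(x_i, m^{N,i}_x)` and `G(x_i, m^{N,i}_x)`. -/
structure SolvesHJB {N : ℕ} (v : Fin N → ℝ → (Fin N → Fin d) → ℝ) : Prop where
  contDiffOn_time : ∀ i x, ContDiffOn ℝ 1 (fun t => v i t x) (Icc 0 𝒢.T)
  equation : ∀ i, ∀ t ∈ Icc 0 𝒢.T, ∀ x,
    - derivWithin (fun s => v i s x) (Icc 0 𝒢.T) t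
      - ∑ j ∈ Finset.univ.erase i,
          inner ℝ (𝒢.αstar (x j) (playerDiff j (v j t) x)) (playerDiff j (v i t) x)
      + 𝒢.H (x i) (playerDiff i (v i t) x)
      = 𝒢.F (x i) (empiricalExcept i x)
  terminal : ∀ i x, v i 𝒢.T x = 𝒢.G (x i) (empiricalExcept i x)

/-- The feedback strategies `α^i(t, x) = α*(x_i, Δ^i w^i(t, x))` induced by functions `w^i`. -/
def feedback {N : ℕ} (w : Fin N → ℝ → (Fin N → Fin d) → ℝ) :
    Fin N → ℝ → (Fin N → Fin d) → Vec d :=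
  fun i t x => 𝒢.αstar (x i) (playerDiff i (w i t) x)

end Game

/-- The projection `u^{N,i}(t, x) = U(t, x_i, m^{N,i}_x)` of a function on
`[0, T] × Σ × P(Σ)`. -/
def projection {d : ℕ} (N : ℕ) (U : ℝ → Fin d → Vec d → ℝ) :
    Fin N → ℝ → (Fin N → Fin d) → ℝ :=
  fun i t x => U t (x i) (empiricalExcept i x)

/-- The space of marks `Ξ = [0, M]^d`. -/
def markSet (d : ℕ) (M : ℝ) : Set (Vec d) := {ξ | ∀ y, ξ y ∈ Icc 0 M}

/-- The intensity `ν(E) = ∑_j ℓ(E ∩ Ξ_j)`, where `Ξ_j` is the part of the `j`-th coordinate axis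
in `Ξ` and `ℓ` is the Lebesgue measure on it. -/
def markIntensity (d : ℕ) (M : ℝ) : Measure (Vec d) :=
  ∑ j : Fin d, Measure.map (fun r : ℝ => (EuclideanSpace.single j r : Vec d))
    (volume.restrict (Icc 0 M))

/-- The intensity `dt ⊗ ν` on `[0, T] × Ξ` of the stationary Poisson random measures. -/
def noiseIntensity (d : ℕ) (T M : ℝ) : Measure (ℝ × Vec d) :=
  (volume.restrict (Icc 0 T)).prod (markIntensity d M)

/-- The jump function `f(x, ξ, a) = ∑_y (y - x) 1_{]0, a_y[}(ξ_y)`. -/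
def jump {d : ℕ} (x : Fin d) (ξ a : Vec d) : ℝ :=
  ∑ y, (label y - label x) * indicator (Ioo 0 (a y)) (fun _ => (1 : ℝ)) (ξ y)

/-- `𝒩` is a Poisson random measure with intensity `μ`: an integer-valued random measure with
independent values on disjoint sets, the value on a set of finite intensity `r` being Poisson
distributed with parameter `r`. -/
structure IsPoissonRandomMeasure {Ω S : Type*} [MeasurableSpace Ω] [MeasurableSpace S]
    (P : Measure Ω) (μ : Measure S) (𝒩 : Ω → Measure S) : Prop where
  measurable : Measurable 𝒩
  integerValued : ∀ ω, ∀ B, MeasurableSet B → ∃ n : ℕ∞, 𝒩 ω B = (n : ℝ≥0∞)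
  law : ∀ B, MeasurableSet B → μ B ≠ ∞ →
    P.map (fun ω => 𝒩 ω B)
      = (poissonMeasure (μ B).toNNReal).map (fun n : ℕ => (n : ℝ≥0∞))
  indep : ∀ (n : ℕ) (B : Fin n → Set S), (∀ k, MeasurableSet (B k)) →
    Pairwise (fun k l => Disjoint (B k) (B l)) → iIndepFun (fun k ω => 𝒩 ω (B k)) P

/-- The noise of the players: independent Poisson random measures with the same intensity
`dt ⊗ ν`, which are Poisson with respect to the filtration `𝓕` (the restriction to times up to
`s` is known at time `s`, the restriction to later times is independent of `𝓕 s`). -/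
structure IsPlayerNoise {d N : ℕ} (T M : ℝ) {Ω : Type*} {mΩ : MeasurableSpace Ω}
    (P : Measure Ω) (𝓕 : Filtration ℝ mΩ) (𝒩 : Fin N → Ω → Measure (ℝ × Vec d)) : Prop where
  poisson : ∀ i, IsPoissonRandomMeasure P (noiseIntensity d T M) (𝒩 i)
  indep : iIndepFun 𝒩 P
  adapted : ∀ s ∈ Icc 0 T, ∀ i,
    Measurable[𝓕 s] (fun ω => (𝒩 i ω).restrict (Iic s ×ˢ univ))
  indep_future : ∀ s ∈ Icc 0 T, Indep (𝓕 s)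
    (⨆ i, MeasurableSpace.comap (fun ω => (𝒩 i ω).restrict (Ioi s ×ˢ univ)) inferInstance) P

/-- Initial states: i.i.d. with distribution `m₀` and known at time `0` (hence independent of
the noise). -/
structure IsInitialDatum {d N : ℕ} {Ω : Type*} {mΩ : MeasurableSpace Ω}
    (P : Measure Ω) (𝓕 : Filtration ℝ mΩ) (m₀ : Vec d) (Z : Fin N → Ω → Fin d) : Prop where
  measurable : ∀ i, Measurable[𝓕 0] (Z i)
  law : ∀ i x, P {ω | Z i ω = x} = ENNReal.ofReal (m₀ x)
  indep : iIndepFun Z P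

/-- A path is càdlàg on `[0, T]`, with values in the discrete state space. -/
def IsCadlag {d : ℕ} (T : ℝ) (φ : ℝ → Fin d) : Prop :=
  (∀ t ∈ Ico 0 T, ContinuousWithinAt φ (Ici t) t) ∧
    ∀ t ∈ Ioc 0 T, ∃ l, Tendsto φ (𝓝[<] t) (𝓝 l)

/-- `X` is a solution on `[0, T]`, adapted and with càdlàg paths, of the system
`X_i(t) = Z_i + ∫_0^t ∫_Ξ f(X_i(s-), ξ, α^i(s, X(s-))) 𝒩_i(ds, dξ)`. -/
structure SolvesSDE {d N : ℕ} (T M : ℝ) {Ω : Type*} {mΩ : MeasurableSpace Ω}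
    (P : Measure Ω) (𝓕 : Filtration ℝ mΩ) (𝒩 : Fin N → Ω → Measure (ℝ × Vec d))
    (Z : Fin N → Ω → Fin d) (α : Fin N → ℝ → (Fin N → Fin d) → Vec d)
    (X : Fin N → ℝ → Ω → Fin d) : Prop where
  adapted : ∀ i, ∀ t ∈ Icc 0 T, Measurable[𝓕 t] (X i t)
  cadlag : ∀ i ω, IsCadlag T (fun t => X i t ω)
  equation : ∀ᵐ ω ∂P, ∀ i, ∀ t ∈ Icc 0 T,
    label (X i t ω) = label (Z i ω)
      + ∫ p in Ioc 0 t ×ˢ markSet d M,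
          jump (Function.leftLim (fun r => X i r ω) p.1) p.2
            (α i p.1 (fun j => Function.leftLim (fun r => X j r ω) p.1)) ∂(𝒩 i ω)

end FiniteMFG

end

/-!
Inserting `u^{N,i}(t, x) = U(t, x_i, m^{N,i}_x)` into the Hamilton-Jacobi-Bellman system leaves a
residual of order `1 / N`: a jump of another player moves the empirical measure by
`(δ_z - δ_y) / (N - 1)`, so `Δ^j u^{N,i}` is `D^m U / (N - 1)` up to an error of order `1 / N ^ 2`,
and the sum over the other players reproduces the nonlocal term of the Master Equation.  At a
maximum of `|u^{N,i} - v^{N,i}|` over players and configurations the differences in the direction of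
each player have a sign, so that, the controls being nonnegative, a Grönwall argument in time gives
`|u^{N,i} - v^{N,i}| ≤ c / N`.  The feedback controls are then `O(1 / N)` apart along equal
configurations, and since both particle systems are driven by the same noise, their mismatch rates
are controlled by this distance and by the number of players that already differ; a second Grönwall
argument closes the estimate on the trajectories.
-/

noncomputable section

namespace FiniteMFG

/-! ### The simplex -/

section Simplex

variable {d : ℕ}

theorem inner_eq_sum (a p : Vec d) : inner ℝ a p = ∑ z, a z * p z := by
  simp [PiLp.inner_apply, mul_comm]

theorem abs_inner_sub_inner_le {E : Type*} [NormedAddCommGroup E] [InnerProductSpace ℝ E]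
    (a b p q : E) : |inner ℝ a q - inner ℝ b p| ≤ ‖a - b‖ * ‖q‖ + ‖b‖ * ‖p - q‖ :=
  calc |inner ℝ a q - inner ℝ b p| = |inner ℝ (a - b) q - inner ℝ b (p - q)| := by
        rw [inner_sub_left, inner_sub_right, sub_sub_sub_cancel_right]
    _ ≤ |inner ℝ (a - b) q| + |inner ℝ b (p - q)| := abs_sub _ _
    _ ≤ ‖a - b‖ * ‖q‖ + ‖b‖ * ‖p - q‖ :=
        add_le_add (abs_real_inner_le_norm _ _) (abs_real_inner_le_norm _ _)

theorem norm_le_sqrt_mul {p : Vec d} {c : ℝ} (hc : 0 ≤ c) (h : ∀ z, |p z| ≤ c) :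
    ‖p‖ ≤ √d * c := by
  have hsum : ∑ z, ‖p z‖ ^ 2 ≤ d * c ^ 2 :=
    calc ∑ z, ‖p z‖ ^ 2 ≤ ∑ _z : Fin d, c ^ 2 :=
          Finset.sum_le_sum fun z _ => pow_le_pow_left₀ (norm_nonneg _) (h z) 2
      _ = d * c ^ 2 := by simp
  calc ‖p‖ = √(∑ z, ‖p z‖ ^ 2) := EuclideanSpace.norm_eq p
    _ ≤ √(d * c ^ 2) := Real.sqrt_le_sqrt hsum
    _ = √d * c := by rw [Real.sqrt_mul d.cast_nonneg, Real.sqrt_sq hc]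

theorem norm_diracVec (x : Fin d) : ‖diracVec x‖ = 1 := by
  simp [diracVec]

theorem diracVec_mem_simplex (x : Fin d) : diracVec x ∈ simplex d := by
  refine ⟨fun y => ?_, by simp [diracVec]⟩
  simp only [diracVec, PiLp.single_apply]
  split_ifs <;> norm_num

theorem norm_diracVec_sub_le (x y : Fin d) : ‖diracVec x - diracVec y‖ ≤ 2 := by
  linarith [norm_sub_le (diracVec x) (diracVec y), norm_diracVec x, norm_diracVec y]

theorem convex_simplex (d : ℕ) : Convex ℝ (simplex d) := by
  intro m hm m' hm' a b ha hb hab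
  refine ⟨fun x => add_nonneg (mul_nonneg ha (hm.1 x)) (mul_nonneg hb (hm'.1 x)), ?_⟩
  simp only [PiLp.add_apply, PiLp.smul_apply, smul_eq_mul, Finset.sum_add_distrib,
    ← Finset.mul_sum, hm.2, hm'.2, mul_one, hab]

theorem isCompact_simplex (d : ℕ) : IsCompact (simplex d) := by
  convert (isCompact_stdSimplex ℝ (Fin d)).image (PiLp.continuous_toLp 2 fun _ : Fin d => ℝ)
  ext m
  exact ⟨fun hm => ⟨m.ofLp, hm, rfl⟩, by rintro ⟨f, hf, rfl⟩; exact hf⟩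

theorem norm_le_one_of_mem_simplex {m : Vec d} (hm : m ∈ simplex d) : ‖m‖ ≤ 1 := by
  have hsum : m = ∑ x, m x • diracVec x := by
    ext z
    simp [diracVec, Pi.single_apply]
  calc ‖m‖ ≤ ∑ x, ‖m x • diracVec x‖ := by
        conv_lhs => rw [hsum]
        exact norm_sum_le _ _
    _ = ∑ x, m x := Finset.sum_congr rfl fun x _ => by
        rw [norm_smul, norm_diracVec, mul_one, Real.norm_of_nonneg (hm.1 x)]
    _ = 1 := hm.2

theorem add_smul_mem_simplex {m e : Vec d} {h s : ℝ} (hm : m ∈ simplex d)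
    (hmh : m + h • e ∈ simplex d) (hs : s ∈ Icc 0 h) : m + s • e ∈ simplex d := by
  obtain rfl | h0 := (hs.1.trans hs.2).eq_or_lt
  · rwa [le_antisymm hs.2 hs.1]
  · have := (convex_simplex d).add_smul_mem hm hmh
      ⟨div_nonneg hs.1 h0.le, (div_le_one h0).2 hs.2⟩
    rwa [smul_smul, div_mul_cancel₀ _ h0.ne'] at this

theorem transfer_mem_simplex {m : Vec d} (hm : m ∈ simplex d) {y : Fin d} (z : Fin d)
    {s : ℝ} (hs : s ∈ Icc 0 (m y)) : m + s • (diracVec z - diracVec y) ∈ simplex d := by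
  refine ⟨fun x => ?_, ?_⟩
  · have hz := (diracVec_mem_simplex z).1 x
    have hy : s * diracVec y x ≤ m x := by
      obtain rfl | hxy := eq_or_ne x y
      · simpa [diracVec] using hs.2
      · simpa [diracVec, hxy] using hm.1 x
    simp only [PiLp.add_apply, PiLp.smul_apply, PiLp.sub_apply, smul_eq_mul]
    linarith [mul_nonneg hs.1 hz]
  · simp only [PiLp.add_apply, PiLp.smul_apply, PiLp.sub_apply, smul_eq_mul,
      Finset.sum_add_distrib, ← Finset.mul_sum, Finset.sum_sub_distrib,
      (diracVec_mem_simplex _).2, hm.2]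
    ring

end Simplex

/-! ### Maximum principles -/

section MaximumPrinciple

variable {S : Type*} [TopologicalSpace S] {s : Set S} {T : ℝ} {f f' : ℝ → S → ℝ}

theorem sign_mul_le_abs {σ : ℝ} (hσ : |σ| = 1) (a : ℝ) : σ * a ≤ |a| := by
  simpa [abs_mul, hσ] using le_abs_self (σ * a)

theorem le_of_deriv_pos_at_max (hs : IsCompact s) {g : ℝ}
    (hcont : ContinuousOn (fun q : ℝ × S => f q.1 q.2) (Icc 0 T ×ˢ s))
    (hderiv : ∀ t ∈ Icc 0 T, ∀ q ∈ s, HasDerivWithinAt (fun t => f t q) (f' t q) (Icc 0 T) t)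
    (hT : ∀ q ∈ s, f T q ≤ g)
    (hpos : ∀ t ∈ Icc 0 T, ∀ q ∈ s, (∀ q' ∈ s, f t q' ≤ f t q) → 0 < f' t q) :
    ∀ t ∈ Icc 0 T, ∀ q ∈ s, f t q ≤ g := by
  intro t ht q hq
  obtain ⟨⟨t₀, q₀⟩, ⟨ht₀, hq₀⟩, hmax⟩ :=
    (isCompact_Icc.prod hs).exists_isMaxOn ⟨(t, q), ht, hq⟩ hcont
  have hle : ∀ t ∈ Icc 0 T, ∀ q ∈ s, f t q ≤ f t₀ q₀ := fun t ht q hq =>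
    isMaxOn_iff.1 hmax (t, q) ⟨ht, hq⟩
  obtain rfl | htT := ht₀.2.eq_or_lt
  · exact (hle t ht q hq).trans (hT q₀ hq₀)
  have hd : HasDerivWithinAt (fun t => f t q₀) (f' t₀ q₀) (Ioi t₀) t₀ :=
    (hderiv t₀ ht₀ q₀ hq₀).mono_of_mem_nhdsWithin (mem_of_superset (Ioc_mem_nhdsGT htT)
      (Ioc_subset_Icc_self.trans (Icc_subset_Icc_left ht₀.1)))
  have hslope : ∀ᶠ r in 𝓝[>] t₀, 0 < slope (fun t => f t q₀) t₀ r :=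
    ((hasDerivWithinAt_iff_tendsto_slope' self_notMem_Ioi).1 hd).eventually_const_lt
      (hpos t₀ ht₀ q₀ hq₀ (hle t₀ ht₀))
  obtain ⟨r, hr, hr'⟩ := (hslope.and (Ioc_mem_nhdsGT htT)).exists
  have hincr := (slope_pos_iff_of_le hr'.1.le).1 hr
  exact absurd (hle r ⟨ht₀.1.trans hr'.1.le, hr'.2⟩ q₀ hq₀) (not_le.2 hincr)

theorem le_add_of_neg_le_deriv_at_max (hs : IsCompact s) {g c : ℝ}
    (hcont : ContinuousOn (fun q : ℝ × S => f q.1 q.2) (Icc 0 T ×ˢ s))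
    (hderiv : ∀ t ∈ Icc 0 T, ∀ q ∈ s, HasDerivWithinAt (fun t => f t q) (f' t q) (Icc 0 T) t)
    (hT : ∀ q ∈ s, f T q ≤ g)
    (hneg : ∀ t ∈ Icc 0 T, ∀ q ∈ s, (∀ q' ∈ s, f t q' ≤ f t q) → -c ≤ f' t q) :
    ∀ t ∈ Icc 0 T, ∀ q ∈ s, f t q ≤ g + c * (T - t) := by
  intro t ht q hq
  have hε : ∀ ε > 0, f t q ≤ g + (c + ε) * (T - t) := by
    intro ε hε
    have := le_of_deriv_pos_at_max hs (g := g)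
      (f := fun t q => f t q + (c + ε) * (t - T)) (f' := fun t q => f' t q + (c + ε))
      (hcont.add (by fun_prop))
      (fun t ht q hq => (hderiv t ht q hq).add (by
        simpa using ((hasDerivWithinAt_id t (Icc 0 T)).sub_const T).const_mul (c + ε)))
      (fun q hq => by simpa using hT q hq)
      (fun t ht q hq hmax => by
        have := hneg t ht q hq fun q' hq' => by simpa using hmax q' hq'
        linarith) t ht q hq
    linarith
  have hlim : Tendsto (fun ε => g + (c + ε) * (T - t)) (𝓝[>] 0) (𝓝 (g + (c + 0) * (T - t))) :=
    (Continuous.tendsto (by fun_prop) 0).mono_left nhdsWithin_le_nhds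
  simpa using ge_of_tendsto hlim (eventually_nhdsWithin_of_forall hε)

theorem abs_le_add_of_neg_le_deriv_at_max (hs : IsCompact s) {g c : ℝ}
    (hcont : ContinuousOn (fun q : ℝ × S => f q.1 q.2) (Icc 0 T ×ˢ s))
    (hderiv : ∀ t ∈ Icc 0 T, ∀ q ∈ s, HasDerivWithinAt (fun t => f t q) (f' t q) (Icc 0 T) t)
    (hT : ∀ q ∈ s, |f T q| ≤ g)
    (hneg : ∀ t ∈ Icc 0 T, ∀ q ∈ s, ∀ σ : ℝ, |σ| = 1 →
      (∀ q' ∈ s, |f t q'| ≤ σ * f t q) → -c ≤ σ * f' t q) :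
    ∀ t ∈ Icc 0 T, ∀ q ∈ s, |f t q| ≤ g + c * (T - t) := by
  have hmem : ∀ σ : ℝ, σ ∈ Metric.sphere (0 : ℝ) 1 ↔ |σ| = 1 := by simp
  have hcont' : ContinuousOn (fun q : ℝ × ℝ × S => f q.1 q.2.2)
      (Icc 0 T ×ˢ Metric.sphere 0 1 ×ˢ s) :=
    hcont.comp (f := fun q : ℝ × ℝ × S => (q.1, q.2.2)) (by fun_prop)
      fun q hq => ⟨hq.1, hq.2.2⟩
  have hsigned := le_add_of_neg_le_deriv_at_max ((isCompact_sphere (0 : ℝ) 1).prod hs) (T := T)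
    (g := g) (c := c) (f := fun t q => q.1 * f t q.2) (f' := fun t q => q.1 * f' t q.2)
    (ContinuousOn.mul (by fun_prop) hcont')
    (fun t ht q hq => (hderiv t ht q.2 hq.2).const_mul q.1)
    (fun q hq => (sign_mul_le_abs ((hmem _).1 hq.1) _).trans (hT q.2 hq.2))
    (fun t ht q hq hmax => hneg t ht q.2 hq.2 q.1 ((hmem _).1 hq.1) fun q' hq' => abs_le'.2
      ⟨by simpa using hmax (1, q') ⟨by simp, hq'⟩, by simpa using hmax (-1, q') ⟨by simp, hq'⟩⟩)
  exact fun t ht q hq => abs_le'.2 ⟨by simpa using hsigned t ht (1, q) ⟨by simp, hq⟩,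
    by simpa using hsigned t ht (-1, q) ⟨by simp, hq⟩⟩

/-- Multiplying by `exp (b t)` absorbs the linear term. -/
theorem abs_le_mul_exp_of_neg_le_deriv_at_max (hs : IsCompact s) {b r : ℝ} (hb : 0 ≤ b)
    (hr : 0 ≤ r) (hcont : ContinuousOn (fun q : ℝ × S => f q.1 q.2) (Icc 0 T ×ˢ s))
    (hderiv : ∀ t ∈ Icc 0 T, ∀ q ∈ s, HasDerivWithinAt (fun t => f t q) (f' t q) (Icc 0 T) t)
    (hT : ∀ q ∈ s, f T q = 0)
    (hneg : ∀ t ∈ Icc 0 T, ∀ q ∈ s, ∀ σ : ℝ, |σ| = 1 →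
      (∀ q' ∈ s, |f t q'| ≤ σ * f t q) → -(b * (σ * f t q) + r) ≤ σ * f' t q) :
    ∀ t ∈ Icc 0 T, ∀ q ∈ s, |f t q| ≤ r * T * Real.exp (b * T) := by
  have hweighted := abs_le_add_of_neg_le_deriv_at_max hs (T := T) (g := 0)
    (c := r * Real.exp (b * T)) (f := fun t q => Real.exp (b * t) * f t q)
    (f' := fun t q => Real.exp (b * t) * b * f t q + Real.exp (b * t) * f' t q)
    (ContinuousOn.mul (by fun_prop) hcont)
    (fun t ht q hq => HasDerivWithinAt.mul
      (by simpa using ((hasDerivWithinAt_id t (Icc 0 T)).const_mul b).exp) (hderiv t ht q hq))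
    (fun q hq => by simp [hT q hq])
    (fun t ht q hq σ hσ hmax => by
      have hexp := Real.exp_pos (b * t)
      have hle : Real.exp (b * t) ≤ Real.exp (b * T) := by gcongr; exact ht.2
      have hd := hneg t ht q hq σ hσ fun q' hq' => by
        have := hmax q' hq'
        rw [abs_mul, abs_of_pos hexp, mul_left_comm] at this
        exact le_of_mul_le_mul_left this hexp
      linarith [mul_le_mul_of_nonneg_left hd hexp.le, mul_le_mul_of_nonneg_left hle hr])
  intro t ht q hq
  calc |f t q| ≤ Real.exp (b * t) * |f t q| :=
        le_mul_of_one_le_left (abs_nonneg _) (Real.one_le_exp (mul_nonneg hb ht.1))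
    _ = |Real.exp (b * t) * f t q| := by rw [abs_mul, Real.abs_exp]
    _ ≤ 0 + r * Real.exp (b * T) * (T - t) := hweighted t ht q hq
    _ ≤ r * T * Real.exp (b * T) := by
        have := mul_nonneg (mul_nonneg hr (Real.exp_pos (b * T)).le) ht.1
        linarith

end MaximumPrinciple

/-! ### The Hamiltonian and the optimal control -/

namespace Game

variable {d : ℕ} (𝒢 : Game d)

theorem M_pos : 0 < 𝒢.M := 𝒢.κ_pos.trans_le 𝒢.κ_le_M

theorem αstar_mem (x : Fin d) (p : Vec d) : 𝒢.αstar x p ∈ 𝒢.controls :=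
  (𝒢.existsUnique_minimizer x p).choose_spec.1.1

theorem αstar_isMinOn (x : Fin d) (p : Vec d) :
    IsMinOn (fun b => 𝒢.L x b + inner ℝ b p) 𝒢.controls (𝒢.αstar x p) :=
  (𝒢.existsUnique_minimizer x p).choose_spec.1.2

theorem αstar_nonneg (x : Fin d) (p : Vec d) (z : Fin d) : 0 ≤ 𝒢.αstar x p z :=
  𝒢.κ_pos.le.trans (𝒢.αstar_mem x p z).1

theorem αstar_le (x : Fin d) (p : Vec d) (z : Fin d) : 𝒢.αstar x p z ≤ 𝒢.M :=
  (𝒢.αstar_mem x p z).2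

theorem norm_αstar_le (x : Fin d) (p : Vec d) : ‖𝒢.αstar x p‖ ≤ √d * 𝒢.M :=
  norm_le_sqrt_mul 𝒢.M_pos.le fun z => by
    rw [abs_of_nonneg (𝒢.αstar_nonneg x p z)]
    exact 𝒢.αstar_le x p z

theorem isGreatest_H (x : Fin d) (p : Vec d) :
    IsGreatest ((fun a => -inner ℝ a p - 𝒢.L x a) '' 𝒢.controls)
      (-inner ℝ (𝒢.αstar x p) p - 𝒢.L x (𝒢.αstar x p)) := by
  refine ⟨⟨_, 𝒢.αstar_mem x p, rfl⟩, ?_⟩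
  rintro _ ⟨a, ha, rfl⟩
  have := isMinOn_iff.1 (𝒢.αstar_isMinOn x p) a ha
  linarith

theorem H_eq (x : Fin d) (p : Vec d) :
    𝒢.H x p = -inner ℝ (𝒢.αstar x p) p - 𝒢.L x (𝒢.αstar x p) :=
  (𝒢.isGreatest_H x p).csSup_eq

theorem le_H (x : Fin d) (p q : Vec d) :
    -inner ℝ (𝒢.αstar x q) p - 𝒢.L x (𝒢.αstar x q) ≤ 𝒢.H x p := by
  rw [H_eq]
  exact (𝒢.isGreatest_H x p).2 ⟨_, 𝒢.αstar_mem x q, rfl⟩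

theorem sign_mul_inner_αstar_nonpos {σ : ℝ} (x : Fin d) (q : Vec d) {p : Vec d}
    (hp : ∀ z, σ * p z ≤ 0) : σ * inner ℝ (𝒢.αstar x q) p ≤ 0 := by
  rw [inner_eq_sum, Finset.mul_sum]
  refine Finset.sum_nonpos fun z _ => ?_
  rw [mul_left_comm]
  exact mul_nonpos_of_nonneg_of_nonpos (𝒢.αstar_nonneg x q z) (hp z)

theorem neg_abs_H_zero_le {σ : ℝ} (hσ : |σ| = 1) (x : Fin d) {p : Vec d}
    (hp : ∀ z, σ * p z ≤ 0) : -|𝒢.H x 0| ≤ σ * 𝒢.H x p := by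
  have h0 := 𝒢.H_eq x 0
  have hp0 := 𝒢.le_H x p 0
  have h0p := 𝒢.le_H x 0 p
  rw [inner_zero_right] at h0 h0p
  obtain rfl | rfl := (abs_eq zero_le_one).1 hσ
  · linarith [neg_abs_le (𝒢.H x 0), 𝒢.sign_mul_inner_αstar_nonpos x 0 hp]
  · linarith [le_abs_self (𝒢.H x 0), 𝒢.sign_mul_inner_αstar_nonpos x p hp, 𝒢.H_eq x p]

end Game

/-! ### Derivatives on the simplex -/

section Differences

variable {d N : ℕ}

theorem stateDiff_apply (g : Fin d → ℝ) (x y : Fin d) : stateDiff g x y = g y - g x := rfl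

theorem playerDiff_apply (j : Fin N) (g : (Fin N → Fin d) → ℝ) (x : Fin N → Fin d) (y : Fin d) :
    playerDiff j g x y = g (Function.update x j y) - g x := rfl

theorem stateDiff_sub (g h : Fin d → ℝ) (x : Fin d) :
    stateDiff (fun y => g y - h y) x = stateDiff g x - stateDiff h x := by
  ext z
  simp only [PiLp.sub_apply, stateDiff_apply]
  ring

theorem playerDiff_sub (j : Fin N) (g h : (Fin N → Fin d) → ℝ) (x : Fin N → Fin d) :
    playerDiff j (fun x => g x - h x) x = playerDiff j g x - playerDiff j h x := by
  ext z
  simp only [PiLp.sub_apply, playerDiff_apply]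
  ring

theorem norm_stateDiff_le {g : Fin d → ℝ} {B : ℝ} (hg : ∀ x, |g x| ≤ B) (x : Fin d) :
    ‖stateDiff g x‖ ≤ √d * (2 * B) := by
  refine norm_le_sqrt_mul (by linarith [(abs_nonneg _).trans (hg x)]) fun z => ?_
  rw [stateDiff_apply]
  linarith [abs_sub (g z) (g x), hg x, hg z]

theorem norm_playerDiff_le {g : (Fin N → Fin d) → ℝ} {B : ℝ} (hg : ∀ x, |g x| ≤ B)
    (j : Fin N) (x : Fin N → Fin d) : ‖playerDiff j g x‖ ≤ √d * (2 * B) := by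
  refine norm_le_sqrt_mul (by linarith [(abs_nonneg _).trans (hg x)]) fun z => ?_
  rw [playerDiff_apply]
  linarith [abs_sub (g (Function.update x j z)) (g x), hg x, hg (Function.update x j z)]

end Differences

/-- `V` moves by at most `c h`, and agrees with its first order expansion up to `c h ^ 2`, when
a mass `h` is transferred from one state to another. -/
structure HasTransferExpansion {d : ℕ} (V : Vec d → ℝ) (D : Vec d → Fin d → Vec d) (c : ℝ) :
    Prop where
  abs_deriv_le : ∀ m ∈ simplex d, ∀ y z, |D m y z| ≤ c
  abs_sub_le : ∀ m ∈ simplex d, ∀ y z, ∀ h ∈ Icc (0 : ℝ) 1,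
    m + h • (diracVec z - diracVec y) ∈ simplex d →
    |V (m + h • (diracVec z - diracVec y)) - V m| ≤ c * h
  abs_sub_sub_le : ∀ m ∈ simplex d, ∀ y z, ∀ h ∈ Icc (0 : ℝ) 1,
    m + h • (diracVec z - diracVec y) ∈ simplex d →
    |V (m + h • (diracVec z - diracVec y)) - V m - h * D m y z| ≤ c * h ^ 2

namespace HasSimplexDeriv

variable {d : ℕ} {V : Vec d → ℝ} {D : Vec d → Fin d → Vec d}

theorem sign_mul_nonpos_of_max (hD : HasSimplexDeriv V D) {σ : ℝ} {m : Vec d}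
    (hm : m ∈ simplex d) (hmax : ∀ m' ∈ simplex d, σ * V m' ≤ σ * V m) {y : Fin d}
    (hy : 0 < m y) (z : Fin d) : σ * D m y z ≤ 0 := by
  have hadm : Ioc 0 (m y) ⊆ {s : ℝ | 0 < s ∧ m + s • (diracVec z - diracVec y) ∈ simplex d} :=
    fun s hs => ⟨hs.1, transfer_mem_simplex hm z ⟨hs.1.le, hs.2⟩⟩
  have hne : (𝓝[{s : ℝ | 0 < s ∧ m + s • (diracVec z - diracVec y) ∈ simplex d}] 0).NeBot :=
    NeBot.mono (nhdsGT_neBot 0)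
      (nhdsWithin_le_iff.2 (mem_of_superset (Ioc_mem_nhdsGT hy) hadm))
  refine le_of_tendsto ((hD m hm y z).const_mul σ)
    (eventually_nhdsWithin_of_forall fun s hs => ?_)
  rw [mul_div_assoc', mul_sub]
  exact div_nonpos_of_nonpos_of_nonneg (sub_nonpos.2 (hmax _ hs.2)) hs.1.le

theorem hasDerivWithinAt (hD : HasSimplexDeriv V D) {m : Vec d} (hm : m ∈ simplex d)
    {y z : Fin d} {h s : ℝ} (hmh : m + h • (diracVec z - diracVec y) ∈ simplex d)
    (hs : s ∈ Ico 0 h) :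
    HasDerivWithinAt (fun r => V (m + r • (diracVec z - diracVec y)))
      (D (m + s • (diracVec z - diracVec y)) y z) (Ici s) s := by
  set e := diracVec z - diracVec y
  have hright : Tendsto (fun r : ℝ => (V (m + s • e + r • e) - V (m + s • e)) / r) (𝓝[>] 0)
      (𝓝 (D (m + s • e) y z)) := by
    refine (hD _ (add_smul_mem_simplex hm hmh ⟨hs.1, hs.2.le⟩) y z).mono_left
      (nhdsWithin_le_iff.2 (mem_of_superset (Ioo_mem_nhdsGT (sub_pos.2 hs.2))
        fun r hr => ⟨hr.1, ?_⟩))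
    rw [add_assoc, ← add_smul]
    exact add_smul_mem_simplex hm hmh ⟨add_nonneg hs.1 hr.1.le, by linarith [hr.2]⟩
  have hshift : Tendsto (fun r => r - s) (𝓝[>] s) (𝓝[>] 0) := by
    refine tendsto_nhdsWithin_iff.2 ⟨?_, eventually_nhdsWithin_of_forall fun r hr => ?_⟩
    · exact ((continuous_sub_right s).tendsto' s 0 (sub_self s)).mono_left nhdsWithin_le_nhds
    · exact mem_Ioi.2 (sub_pos.2 hr)
  rw [← hasDerivWithinAt_Ioi_iff_Ici, hasDerivWithinAt_iff_tendsto_slope' self_notMem_Ioi]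
  refine (hright.comp hshift).congr fun r => ?_
  rw [Function.comp, slope_def_field, add_assoc, ← add_smul, add_sub_cancel]

theorem abs_sub_sub_le (hD : HasSimplexDeriv V D) (hV : ContinuousOn V (simplex d)) {C : ℝ≥0}
    {y : Fin d} (hLip : LipschitzOnWith C (fun m => D m y) (simplex d))
    {m : Vec d} (hm : m ∈ simplex d) {z : Fin d} {h : ℝ} (hh : 0 ≤ h)
    (hmh : m + h • (diracVec z - diracVec y) ∈ simplex d) :
    |V (m + h • (diracVec z - diracVec y)) - V m - h * D m y z| ≤ 2 * C * h ^ 2 := by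
  set e := diracVec z - diracVec y
  have hmem : ∀ s ∈ Icc 0 h, m + s • e ∈ simplex d := fun s hs => add_smul_mem_simplex hm hmh hs
  have hderiv : ∀ s ∈ Ico 0 h, ‖D (m + s • e) y z - D m y z‖ ≤ 2 * C * h := fun s hs =>
    calc ‖D (m + s • e) y z - D m y z‖ ≤ ‖D (m + s • e) y - D m y‖ :=
          PiLp.norm_apply_le (D (m + s • e) y - D m y) z
      _ ≤ C * ‖m + s • e - m‖ := hLip.norm_sub_le (hmem s ⟨hs.1, hs.2.le⟩) hm
      _ = C * (s * ‖e‖) := by rw [add_sub_cancel_left, norm_smul, Real.norm_of_nonneg hs.1]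
      _ ≤ C * (h * 2) := by gcongr; exacts [hs.2.le, norm_diracVec_sub_le z y]
      _ = 2 * C * h := by ring
  have hsegment := norm_image_sub_le_of_norm_deriv_right_le_segment
    (f := fun s => V (m + s • e) - s * D m y z) (a := 0) (b := h)
    ((hV.comp (by fun_prop) hmem).sub (by fun_prop))
    (fun s hs => (hD.hasDerivWithinAt hm hmh hs).sub (by
      simpa using (hasDerivWithinAt_id s (Ici s)).mul_const (D m y z)))
    hderiv h (right_mem_Icc.2 hh)
  simp only [Real.norm_eq_abs, zero_smul, add_zero, zero_mul, sub_zero] at hsegment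
  calc |V (m + h • e) - V m - h * D m y z| = |V (m + h • e) - h * D m y z - V m| := by
        rw [sub_right_comm]
    _ ≤ 2 * C * h * h := hsegment
    _ = 2 * C * h ^ 2 := by ring

theorem abs_apply_le (hD : HasSimplexDeriv V D) (hV : ContinuousOn V (simplex d)) {B : ℝ}
    (hB : ∀ m ∈ simplex d, |V m| ≤ B) {C : ℝ≥0} {y : Fin d}
    (hLip : LipschitzOnWith C (fun m => D m y) (simplex d))
    {m : Vec d} (hm : m ∈ simplex d) (z : Fin d) : |D m y z| ≤ 2 * B + 4 * C := by
  have hy := diracVec_mem_simplex y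
  have hz := diracVec_mem_simplex z
  have hvertex : |V (diracVec z) - V (diracVec y) - D (diracVec y) y z| ≤ 2 * C := by
    simpa using hD.abs_sub_sub_le hV hLip hy (z := z) zero_le_one (by simpa using hz)
  have hmove : |D m y z - D (diracVec y) y z| ≤ C * 2 :=
    calc |D m y z - D (diracVec y) y z| ≤ ‖D m y - D (diracVec y) y‖ :=
          PiLp.norm_apply_le (D m y - D (diracVec y) y) z
      _ ≤ C * ‖m - diracVec y‖ := hLip.norm_sub_le hm hy
      _ ≤ C * 2 := by
          gcongr
          linarith [norm_sub_le m (diracVec y), norm_le_one_of_mem_simplex hm, norm_diracVec y]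
  have hBy := abs_le.1 (hB _ hy)
  have hBz := abs_le.1 (hB _ hz)
  rw [abs_le] at hvertex hmove ⊢
  constructor <;> linarith

theorem hasTransferExpansion (hD : HasSimplexDeriv V D) (hV : ContinuousOn V (simplex d))
    {B : ℝ} (hB : ∀ m ∈ simplex d, |V m| ≤ B) {C : ℝ≥0}
    (hLip : ∀ y, LipschitzOnWith C (fun m => D m y) (simplex d)) :
    HasTransferExpansion V D (2 * B + 6 * C) where
  abs_deriv_le m hm y z := by
    linarith [hD.abs_apply_le hV hB (hLip y) hm z, C.coe_nonneg]
  abs_sub_le m hm y z h hh hmh := by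
    have hexp := hD.abs_sub_sub_le hV (hLip y) hm hh.1 hmh
    have hlin : |h * D m y z| ≤ h * (2 * B + 4 * C) := by
      rw [abs_mul, abs_of_nonneg hh.1]
      exact mul_le_mul_of_nonneg_left (hD.abs_apply_le hV hB (hLip y) hm z) hh.1
    have hquad : C * h ^ 2 ≤ C * h := by nlinarith [mul_nonneg C.coe_nonneg hh.1, hh.2]
    rw [abs_le] at hexp hlin ⊢
    constructor <;> linarith
  abs_sub_sub_le m hm y z h hh hmh := by
    have hB0 := (abs_nonneg _).trans (hB m hm)
    refine (hD.abs_sub_sub_le hV (hLip y) hm hh.1 hmh).trans ?_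
    gcongr
    linarith [C.coe_nonneg]

end HasSimplexDeriv

/-! ### A priori bounds -/

namespace Game

variable {d : ℕ} {𝒢 : Game d}

theorem hasDerivWithinAt_of_contDiffOn {f : ℝ → ℝ} {s : Set ℝ} (hf : ContDiffOn ℝ 1 f s)
    {t : ℝ} (ht : t ∈ s) : HasDerivWithinAt f (derivWithin f s t) s t :=
  (hf.differentiableOn one_ne_zero t ht).hasDerivWithinAt

namespace IsClassicalSolution

variable {U : ℝ → Fin d → Vec d → ℝ} {D : ℝ → Fin d → Vec d → Fin d → Vec d}

theorem continuousOn_uncurried (hU : 𝒢.IsClassicalSolution U D) :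
    ContinuousOn (fun q : ℝ × Fin d × Vec d => U q.1 q.2.1 q.2.2)
      (Icc 0 𝒢.T ×ˢ (univ : Set (Fin d)) ×ˢ simplex d) := by
  rintro ⟨t, x, m⟩ ⟨ht, -, hm⟩
  have hfixed : ContinuousOn (fun q : ℝ × Fin d × Vec d => U q.1 x q.2.2)
      (Icc 0 𝒢.T ×ˢ (univ : Set (Fin d)) ×ˢ simplex d) :=
    (hU.continuousOn x).comp (f := fun q : ℝ × Fin d × Vec d => (q.1, q.2.2))
      (by fun_prop) fun q hq => ⟨hq.1, hq.2.2⟩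
  have hstate : ∀ᶠ q : ℝ × Fin d × Vec d in 𝓝 (t, x, m), q.2.1 = x :=
    (continuous_snd.fst.tendsto (t, x, m)).eventually
      ((isOpen_discrete {x}).mem_nhds (mem_singleton x))
  refine (hfixed (t, x, m) ⟨ht, mem_univ _, hm⟩).congr_of_eventuallyEq ?_ rfl
  filter_upwards [nhdsWithin_le_nhds hstate] with q hq
  rw [hq]

theorem continuousOn_simplex (hU : 𝒢.IsClassicalSolution U D) {t : ℝ} (ht : t ∈ Icc 0 𝒢.T)
    (x : Fin d) : ContinuousOn (U t x) (simplex d) :=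
  (hU.continuousOn x).comp (f := fun m => (t, m)) (by fun_prop) fun _ hm => ⟨ht, hm⟩

theorem sign_mul_nonlocal_nonpos_of_max (hU : 𝒢.IsClassicalSolution U D) {t : ℝ}
    (ht : t ∈ Icc 0 𝒢.T) {σ : ℝ} {x : Fin d} {m : Vec d} (hm : m ∈ simplex d)
    (hmax : ∀ m' ∈ simplex d, σ * U t x m' ≤ σ * U t x m) (p : Fin d → Vec d) :
    σ * ∑ y, m y * inner ℝ (D t x m y) (𝒢.αstar y (p y)) ≤ 0 := by
  rw [Finset.mul_sum]
  refine Finset.sum_nonpos fun y _ => ?_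
  rw [mul_left_comm, real_inner_comm]
  obtain h0 | h0 := (hm.1 y).eq_or_lt
  · rw [← h0, zero_mul]
  · exact mul_nonpos_of_nonneg_of_nonpos h0.le (𝒢.sign_mul_inner_αstar_nonpos _ _ fun z =>
      (hU.hasSimplexDeriv t ht x).sign_mul_nonpos_of_max hm hmax h0 z)

theorem abs_value_le (hU : 𝒢.IsClassicalSolution U D) {cH cF cG : ℝ}
    (hH : ∀ x, |𝒢.H x 0| ≤ cH) (hF : ∀ x, ∀ m ∈ simplex d, |𝒢.F x m| ≤ cF)
    (hG : ∀ x, ∀ m ∈ simplex d, |𝒢.G x m| ≤ cG) {t : ℝ} (ht : t ∈ Icc 0 𝒢.T) (x : Fin d)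
    {m : Vec d} (hm : m ∈ simplex d) : |U t x m| ≤ 𝒢.T * (cH + cF) + cG := by
  have hbound := abs_le_add_of_neg_le_deriv_at_max (isCompact_univ.prod (isCompact_simplex d))
    (g := cG) (c := cH + cF) (f := fun t q => U t q.1 q.2)
    (f' := fun t q => derivWithin (fun s => U s q.1 q.2) (Icc 0 𝒢.T) t) hU.continuousOn_uncurried
    (fun t ht q hq => hasDerivWithinAt_of_contDiffOn (hU.contDiffOn_time q.1 q.2 hq.2) ht)
    (fun q hq => by rw [hU.terminal _ _ hq.2]; exact hG _ _ hq.2)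
    (fun t ht ⟨x, m⟩ ⟨_, hm⟩ σ hσ hmax => by
      have hmaxσ : ∀ x', ∀ m' ∈ simplex d, σ * U t x' m' ≤ σ * U t x m := fun x' m' hm' =>
        (sign_mul_le_abs hσ _).trans (hmax (x', m') ⟨mem_univ _, hm'⟩)
      have hham := 𝒢.neg_abs_H_zero_le hσ x (p := stateDiff (fun y => U t y m) x) fun z => by
        rw [stateDiff_apply, mul_sub]
        exact sub_nonpos.2 (hmaxσ z m hm)
      have hnonlocal := hU.sign_mul_nonlocal_nonpos_of_max ht hm (hmaxσ x)
        fun y => stateDiff (fun z => U t z m) y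
      have hrun := (sign_mul_le_abs hσ _).trans (hF x m hm)
      rw [← hU.equation t ht x m hm] at hrun
      linarith [hH x]) t ht (x, m) ⟨mem_univ _, hm⟩
  have hsum : 0 ≤ cH + cF :=
    add_nonneg ((abs_nonneg _).trans (hH x)) ((abs_nonneg _).trans (hF x m hm))
  linarith [mul_nonneg hsum ht.1]

theorem norm_stateDiff_le (hU : 𝒢.IsClassicalSolution U D) {K : ℝ} (hK : 𝒢.IsAprioriRadius K)
    {t : ℝ} (ht : t ∈ Icc 0 𝒢.T) {m : Vec d} (hm : m ∈ simplex d) (x : Fin d) :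
    ‖stateDiff (fun y => U t y m) x‖ ≤ K := by
  obtain ⟨cH, cF, cG, hH, hF, hG, hle⟩ := hK
  have := FiniteMFG.norm_stateDiff_le (fun y => hU.abs_value_le hH hF hG ht y hm) x
  linarith

theorem exists_abs_le (hU : 𝒢.IsClassicalSolution U D) :
    ∃ B : ℝ, ∀ t ∈ Icc 0 𝒢.T, ∀ x, ∀ m ∈ simplex d, |U t x m| ≤ B := by
  obtain ⟨B, hB⟩ := (isCompact_Icc.prod (isCompact_univ.prod
    (isCompact_simplex d))).exists_bound_of_continuousOn hU.continuousOn_uncurried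
  exact ⟨B, fun t ht x m hm => hB (t, x, m) ⟨ht, mem_univ x, hm⟩⟩

end IsClassicalSolution

end Game

namespace Game

variable {d N : ℕ} {𝒢 : Game d}

/-- The constants of (H1) are chosen uniformly in the state. -/
def UniformH1 {d : ℕ} (𝒢 : Game d) (K : ℝ) (L : ℝ≥0) : Prop :=
  ∀ x, LipschitzOnWith L (𝒢.H x) (Metric.closedBall 0 K) ∧
    LipschitzOnWith L (𝒢.αstar x) (Metric.closedBall 0 K)

theorem H1.exists_uniformH1 {K : ℝ} (h : 𝒢.H1 K) : ∃ L, 𝒢.UniformH1 K L := by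
  choose L hL using h
  exact ⟨Finset.univ.sup L, fun x => ⟨(hL x).1.weaken (Finset.le_sup (Finset.mem_univ x)),
    (hL x).2.weaken (Finset.le_sup (Finset.mem_univ x))⟩⟩

namespace UniformH1

variable {K : ℝ} {L : ℝ≥0} {p q : Vec d}

theorem abs_H_sub_le (h : 𝒢.UniformH1 K L) (x : Fin d) (hp : ‖p‖ ≤ K) (hq : ‖q‖ ≤ K) :
    |𝒢.H x p - 𝒢.H x q| ≤ L * ‖p - q‖ :=
  (h x).1.norm_sub_le (mem_closedBall_zero_iff.2 hp) (mem_closedBall_zero_iff.2 hq)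

theorem norm_αstar_sub_le (h : 𝒢.UniformH1 K L) (x : Fin d) (hp : ‖p‖ ≤ K) (hq : ‖q‖ ≤ K) :
    ‖𝒢.αstar x p - 𝒢.αstar x q‖ ≤ L * ‖p - q‖ :=
  (h x).2.norm_sub_le (mem_closedBall_zero_iff.2 hp) (mem_closedBall_zero_iff.2 hq)

end UniformH1

theorem IsRegularSolution.exists_hasTransferExpansion {U : ℝ → Fin d → Vec d → ℝ}
    (hU : 𝒢.IsRegularSolution U) : ∃ D, 𝒢.IsClassicalSolution U D ∧
      ∃ c : ℝ, 0 ≤ c ∧ ∀ t ∈ Icc 0 𝒢.T, ∀ x, HasTransferExpansion (U t x) (D t x) c := by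
  obtain ⟨D, hD, C, hC⟩ := hU
  obtain ⟨B, hB⟩ := hD.exists_abs_le
  refine ⟨D, hD, 2 * |B| + 6 * C.toNNReal, by positivity, fun t ht x => ?_⟩
  refine (hD.hasSimplexDeriv t ht x).hasTransferExpansion (hD.continuousOn_simplex ht x)
    (fun m hm => (hB t ht x m hm).trans (le_abs_self B)) fun y => ?_
  refine LipschitzOnWith.of_dist_le_mul fun m hm m' hm' => ?_
  rw [dist_eq_norm, dist_eq_norm]
  exact (hC t ht x y m hm m' hm').trans (by gcongr; exact Real.le_coe_toNNReal C)

end Game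

/-! ### Empirical measures -/

section Empirical

variable {d N : ℕ}

theorem inv_pred_pos (hN : 2 ≤ N) : 0 < ((N : ℝ) - 1)⁻¹ := by
  have : (2 : ℝ) ≤ N := by exact_mod_cast hN
  exact inv_pos.2 (by linarith)

theorem inv_pred_le_one (hN : 2 ≤ N) : ((N : ℝ) - 1)⁻¹ ≤ 1 := by
  have : (2 : ℝ) ≤ N := by exact_mod_cast hN
  exact inv_le_one_of_one_le₀ (by linarith)

theorem inv_pred_le_two_div (hN : 2 ≤ N) : ((N : ℝ) - 1)⁻¹ ≤ 2 / N := by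
  have : (2 : ℝ) ≤ N := by exact_mod_cast hN
  rw [inv_eq_one_div, div_le_div_iff₀] <;> linarith

theorem card_erase_mul_inv_pred (hN : 2 ≤ N) (i : Fin N) :
    ((Finset.univ.erase i).card : ℝ) * ((N : ℝ) - 1)⁻¹ = 1 := by
  have : (2 : ℝ) ≤ N := by exact_mod_cast hN
  rw [Finset.card_erase_of_mem (Finset.mem_univ i), Finset.card_univ, Fintype.card_fin,
    Nat.cast_sub (by omega), Nat.cast_one]
  exact mul_inv_cancel₀ (by linarith)

theorem sum_empiricalExcept_mul (i : Fin N) (x : Fin N → Fin d) (f : Fin d → ℝ) :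
    ∑ y, empiricalExcept i x y * f y
      = ((N : ℝ) - 1)⁻¹ * ∑ j ∈ Finset.univ.erase i, f (x j) := by
  have happly : ∀ y, empiricalExcept i x y
      = ((N : ℝ) - 1)⁻¹ * ∑ j ∈ Finset.univ.erase i, diracVec (x j) y := fun y => by
    simp [empiricalExcept]
  simp only [happly, mul_assoc, ← Finset.mul_sum, Finset.sum_mul]
  rw [Finset.sum_comm]
  simp [diracVec]

theorem empiricalExcept_mem_simplex (hN : 2 ≤ N) (i : Fin N) (x : Fin N → Fin d) :
    empiricalExcept i x ∈ simplex d := by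
  refine ⟨fun y => ?_, ?_⟩
  · simp only [empiricalExcept, PiLp.smul_apply, WithLp.ofLp_sum, Finset.sum_apply, smul_eq_mul]
    exact mul_nonneg (inv_pred_pos hN).le
      (Finset.sum_nonneg fun j _ => (diracVec_mem_simplex (x j)).1 y)
  · have hmass := sum_empiricalExcept_mul i x fun _ => 1
    simp only [mul_one, Finset.sum_const, nsmul_eq_mul] at hmass
    rw [hmass, mul_comm, card_erase_mul_inv_pred hN]

theorem empiricalExcept_update_self (i : Fin N) (x : Fin N → Fin d) (z : Fin d) :
    empiricalExcept i (Function.update x i z) = empiricalExcept i x := by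
  unfold empiricalExcept
  congr 1
  exact Finset.sum_congr rfl fun j hj => by
    rw [Function.update_of_ne (Finset.ne_of_mem_erase hj)]

theorem empiricalExcept_update_of_ne {i j : Fin N} (hij : j ≠ i) (x : Fin N → Fin d) (z : Fin d) :
    empiricalExcept i (Function.update x j z)
      = empiricalExcept i x + ((N : ℝ) - 1)⁻¹ • (diracVec z - diracVec (x j)) := by
  have hj : j ∈ Finset.univ.erase i := Finset.mem_erase.2 ⟨hij, Finset.mem_univ _⟩
  have hrest : ∑ k ∈ (Finset.univ.erase i).erase j, diracVec (Function.update x j z k)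
      = ∑ k ∈ (Finset.univ.erase i).erase j, diracVec (x k) :=
    Finset.sum_congr rfl fun k hk => by rw [Function.update_of_ne (Finset.ne_of_mem_erase hk)]
  rw [empiricalExcept, empiricalExcept, ← smul_add, ← Finset.add_sum_erase _ _ hj,
    ← Finset.add_sum_erase _ (fun k => diracVec (x k)) hj, Function.update_self, hrest]
  congr 1
  abel

theorem empiricalExcept_eq_add (i j : Fin N) (x : Fin N → Fin d) :
    empiricalExcept i x
      = empiricalExcept j x + ((N : ℝ) - 1)⁻¹ • (diracVec (x j) - diracVec (x i)) := by
  rw [empiricalExcept, empiricalExcept, ← smul_add,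
    Finset.sum_erase_eq_sub (Finset.mem_univ i), Finset.sum_erase_eq_sub (Finset.mem_univ j)]
  congr 1
  abel

theorem playerDiff_projection_self (U : ℝ → Fin d → Vec d → ℝ) (i : Fin N) (t : ℝ)
    (x : Fin N → Fin d) : playerDiff i (projection N U i t) x
      = stateDiff (fun y => U t y (empiricalExcept i x)) (x i) := by
  ext z
  rw [playerDiff_apply, stateDiff_apply, projection, projection, Function.update_self,
    empiricalExcept_update_self]

theorem playerDiff_projection_of_ne (U : ℝ → Fin d → Vec d → ℝ) {i j : Fin N} (hij : j ≠ i)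
    (t : ℝ) (x : Fin N → Fin d) (z : Fin d) : playerDiff j (projection N U i t) x z
      = U t (x i) (empiricalExcept i x + ((N : ℝ) - 1)⁻¹ • (diracVec z - diracVec (x j)))
        - U t (x i) (empiricalExcept i x) := by
  rw [playerDiff_apply, projection, projection, Function.update_of_ne hij.symm,
    empiricalExcept_update_of_ne hij]

theorem abs_sub_le_mul_hammingDist {ι α : Type*} [Fintype ι] [DecidableEq ι] [DecidableEq α]
    {g : (ι → α) → ℝ} {c : ℝ} (hg : ∀ x j z, |g (Function.update x j z) - g x| ≤ c)
    (x y : ι → α) : |g y - g x| ≤ c * hammingDist x y := by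
  have hpiecewise : ∀ s : Finset ι, |g (s.piecewise y x) - g x| ≤ c * s.card := by
    intro s
    induction s using Finset.induction with
    | empty => simp
    | insert j s hj ih =>
      rw [Finset.piecewise_insert, Finset.card_insert_of_notMem hj]
      have hstep := hg (s.piecewise y x) j (y j)
      have htri := abs_sub_le (g (Function.update (s.piecewise y x) j (y j)))
        (g (s.piecewise y x)) (g x)
      push_cast
      linarith
  have hy : ({j | x j ≠ y j} : Finset ι).piecewise y x = y := by
    ext j
    by_cases hj : x j = y j <;> simp [Finset.piecewise, hj]
  calc |g y - g x| = |g (({j | x j ≠ y j} : Finset ι).piecewise y x) - g x| := by rw [hy]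
    _ ≤ c * hammingDist x y := hpiecewise _

namespace HasTransferExpansion

variable {V : Vec d → ℝ} {D : Vec d → Fin d → Vec d} {c : ℝ}

theorem abs_empiricalExcept_sub_le (hV : HasTransferExpansion V D c) (hN : 2 ≤ N) (i j : Fin N)
    (x : Fin N → Fin d) :
    |V (empiricalExcept i x) - V (empiricalExcept j x)| ≤ c * ((N : ℝ) - 1)⁻¹ := by
  have hi := empiricalExcept_mem_simplex hN i x
  rw [empiricalExcept_eq_add i j x] at hi ⊢
  exact hV.abs_sub_le _ (empiricalExcept_mem_simplex hN j x) _ _ _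
    ⟨(inv_pred_pos hN).le, inv_pred_le_one hN⟩ hi

theorem abs_update_sub_le (hV : HasTransferExpansion V D c) (hc : 0 ≤ c) (hN : 2 ≤ N)
    (i : Fin N) (x : Fin N → Fin d) (j : Fin N) (z : Fin d) :
    |V (empiricalExcept i (Function.update x j z)) - V (empiricalExcept i x)|
      ≤ c * ((N : ℝ) - 1)⁻¹ := by
  have hε := inv_pred_pos hN
  obtain rfl | hij := eq_or_ne j i
  · rw [empiricalExcept_update_self, sub_self, abs_zero]
    positivity
  · have hmem := empiricalExcept_mem_simplex hN i (Function.update x j z)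
    rw [empiricalExcept_update_of_ne hij] at hmem ⊢
    exact hV.abs_sub_le _ (empiricalExcept_mem_simplex hN i x) _ _ _
      ⟨hε.le, inv_pred_le_one hN⟩ hmem

end HasTransferExpansion

end Empirical

/-! ### The Hamilton-Jacobi-Bellman system -/

namespace Game

variable {d N : ℕ} {𝒢 : Game d}

/-- The term `∑_{j ≠ i} α*(x_j, Δ^j w^j) · Δ^j w^i` by which the controls of the other players
enter the equation for `w^i`. -/
def interaction {d N : ℕ} (𝒢 : Game d) (w : Fin N → ℝ → (Fin N → Fin d) → ℝ) (i : Fin N) (t : ℝ)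
    (x : Fin N → Fin d) : ℝ :=
  ∑ j ∈ Finset.univ.erase i, inner ℝ (𝒢.feedback w j t x) (playerDiff j (w i t) x)

/-- The amount by which `w` fails to satisfy the `i`-th equation of the
Hamilton-Jacobi-Bellman system. -/
def hjbResidual {d N : ℕ} (𝒢 : Game d) (w : Fin N → ℝ → (Fin N → Fin d) → ℝ) (i : Fin N) (t : ℝ)
    (x : Fin N → Fin d) : ℝ :=
  -derivWithin (fun s => w i s x) (Icc 0 𝒢.T) t - 𝒢.interaction w i t x
    + 𝒢.H (x i) (playerDiff i (w i t) x) - 𝒢.F (x i) (empiricalExcept i x)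

theorem continuousOn_of_contDiffOn_time {ι : Type*} [TopologicalSpace ι] [DiscreteTopology ι]
    {f : ℝ → ι → ℝ} {s : Set ℝ} (hf : ∀ q, ContDiffOn ℝ 1 (fun t => f t q) s) :
    ContinuousOn (fun q : ℝ × ι => f q.1 q.2) (s ×ˢ univ) :=
  continuousOn_prod_of_discrete_right.2 fun q => (hf q).continuousOn.mono fun _ ht => ht.1

namespace SolvesHJB

variable {v : Fin N → ℝ → (Fin N → Fin d) → ℝ}

theorem hjbResidual_eq_zero (hv : 𝒢.SolvesHJB v) (i : Fin N) {t : ℝ} (ht : t ∈ Icc 0 𝒢.T)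
    (x : Fin N → Fin d) : 𝒢.hjbResidual v i t x = 0 :=
  sub_eq_zero.2 (hv.equation i t ht x)

theorem abs_value_le (hv : 𝒢.SolvesHJB v) (hN : 2 ≤ N) {cH cF cG : ℝ}
    (hH : ∀ x, |𝒢.H x 0| ≤ cH) (hF : ∀ x, ∀ m ∈ simplex d, |𝒢.F x m| ≤ cF)
    (hG : ∀ x, ∀ m ∈ simplex d, |𝒢.G x m| ≤ cG) (i : Fin N) {t : ℝ} (ht : t ∈ Icc 0 𝒢.T)
    (x : Fin N → Fin d) : |v i t x| ≤ 𝒢.T * (cH + cF) + cG := by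
  have hmem := fun x : Fin N → Fin d => empiricalExcept_mem_simplex hN i x
  have hbound := abs_le_add_of_neg_le_deriv_at_max (isCompact_univ (X := Fin N → Fin d))
    (g := cG) (c := cH + cF) (f := v i)
    (f' := fun t x => derivWithin (fun s => v i s x) (Icc 0 𝒢.T) t)
    (continuousOn_of_contDiffOn_time (hv.contDiffOn_time i))
    (fun t ht x _ => hasDerivWithinAt_of_contDiffOn (hv.contDiffOn_time i x) ht)
    (fun x _ => by rw [hv.terminal]; exact hG _ _ (hmem x))
    (fun t ht x _ σ hσ hmax => by
      have hdiff : ∀ j z, σ * playerDiff j (v i t) x z ≤ 0 := fun j z => by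
        rw [playerDiff_apply, mul_sub]
        exact sub_nonpos.2 ((sign_mul_le_abs hσ _).trans (hmax _ (mem_univ _)))
      have hham := 𝒢.neg_abs_H_zero_le hσ (x i) (hdiff i)
      have hinter : σ * 𝒢.interaction v i t x ≤ 0 := by
        rw [interaction, Finset.mul_sum]
        exact Finset.sum_nonpos fun j _ => 𝒢.sign_mul_inner_αstar_nonpos _ _ (hdiff j)
      have hrun := (sign_mul_le_abs hσ _).trans (hF (x i) _ (hmem x))
      rw [← hv.equation i t ht x, ← sub_nonneg] at hrun
      simp only [interaction, feedback] at hinter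
      linarith [hH (x i)]) t ht x (mem_univ _)
  have hsum : 0 ≤ cH + cF :=
    add_nonneg ((abs_nonneg _).trans (hH (x i))) ((abs_nonneg _).trans (hF (x i) _ (hmem x)))
  linarith [mul_nonneg hsum ht.1]

theorem norm_playerDiff_le (hv : 𝒢.SolvesHJB v) (hN : 2 ≤ N) {K : ℝ}
    (hK : 𝒢.IsAprioriRadius K) (i j : Fin N) {t : ℝ} (ht : t ∈ Icc 0 𝒢.T) (x : Fin N → Fin d) :
    ‖playerDiff j (v i t) x‖ ≤ K := by
  obtain ⟨cH, cF, cG, hH, hF, hG, hle⟩ := hK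
  have := FiniteMFG.norm_playerDiff_le (fun y => hv.abs_value_le hN hH hF hG i ht y) j x
  linarith

end SolvesHJB

section Stability

variable {K : ℝ} {L : ℝ≥0} {u v : Fin N → ℝ → (Fin N → Fin d) → ℝ} {t W : ℝ}
  {x : Fin N → Fin d}

theorem norm_playerDiff_sub_le (hW : ∀ j y, |u j t y - v j t y| ≤ W) (j : Fin N) :
    ‖playerDiff j (u j t) x - playerDiff j (v j t) x‖ ≤ √d * (2 * W) := by
  rw [← playerDiff_sub]
  exact norm_playerDiff_le (hW j) j x

theorem sign_mul_interaction_sub_le (hL : 𝒢.UniformH1 K L)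
    (hu : ∀ j, ‖playerDiff j (u j t) x‖ ≤ K) (hv : ∀ j, ‖playerDiff j (v j t) x‖ ≤ K) {c : ℝ}
    {i : Fin N} (hc : ∑ j ∈ Finset.univ.erase i, ‖playerDiff j (u i t) x‖ ≤ c) {σ : ℝ}
    (hσ : |σ| = 1) (hmax : ∀ j y, |u j t y - v j t y| ≤ σ * (u i t x - v i t x)) :
    σ * (𝒢.interaction u i t x - 𝒢.interaction v i t x)
      ≤ L * (√d * (2 * (σ * (u i t x - v i t x)))) * c := by
  set W := σ * (u i t x - v i t x)
  have hW : 0 ≤ W := (abs_nonneg _).trans (hmax i x)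
  have hterm : ∀ j, σ * (inner ℝ (𝒢.feedback u j t x) (playerDiff j (u i t) x)
      - inner ℝ (𝒢.feedback v j t x) (playerDiff j (v i t) x))
      ≤ L * (√d * (2 * W)) * ‖playerDiff j (u i t) x‖ := by
    intro j
    have hcontrol : ‖𝒢.feedback u j t x - 𝒢.feedback v j t x‖ ≤ L * (√d * (2 * W)) :=
      (hL.norm_αstar_sub_le (x j) (hu j) (hv j)).trans
        (mul_le_mul_of_nonneg_left (norm_playerDiff_sub_le hmax j) L.coe_nonneg)
    have hfirst := (sign_mul_le_abs hσ
      (inner ℝ (𝒢.feedback u j t x - 𝒢.feedback v j t x) (playerDiff j (u i t) x))).trans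
      ((abs_real_inner_le_norm _ _).trans (mul_le_mul_of_nonneg_right hcontrol (norm_nonneg _)))
    have hsecond : σ * inner ℝ (𝒢.feedback v j t x)
        (playerDiff j (u i t) x - playerDiff j (v i t) x) ≤ 0 :=
      𝒢.sign_mul_inner_αstar_nonpos _ _ fun z => by
        rw [← playerDiff_sub, playerDiff_apply, mul_sub]
        exact sub_nonpos.2 ((sign_mul_le_abs hσ _).trans (hmax i _))
    rw [inner_sub_left] at hfirst
    rw [inner_sub_right] at hsecond
    linarith
  rw [interaction, interaction, ← Finset.sum_sub_distrib, Finset.mul_sum]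
  calc _ ≤ ∑ j ∈ Finset.univ.erase i, L * (√d * (2 * W)) * ‖playerDiff j (u i t) x‖ :=
        Finset.sum_le_sum fun j _ => hterm j
    _ ≤ L * (√d * (2 * W)) * c := by rw [← Finset.mul_sum]; gcongr

theorem abs_sub_le_of_abs_hjbResidual_le (hL : 𝒢.UniformH1 K L) {r c : ℝ} (hr : 0 ≤ r)
    (hc : 0 ≤ c) (hu : ∀ i x, ContDiffOn ℝ 1 (fun t => u i t x) (Icc 0 𝒢.T))
    (hv : 𝒢.SolvesHJB v) (hT : ∀ i x, u i 𝒢.T x = v i 𝒢.T x)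
    (hres : ∀ i, ∀ t ∈ Icc 0 𝒢.T, ∀ x, |𝒢.hjbResidual u i t x| ≤ r)
    (huK : ∀ i, ∀ t ∈ Icc 0 𝒢.T, ∀ x, ‖playerDiff i (u i t) x‖ ≤ K)
    (hvK : ∀ i, ∀ t ∈ Icc 0 𝒢.T, ∀ x, ‖playerDiff i (v i t) x‖ ≤ K)
    (hcross : ∀ i, ∀ t ∈ Icc 0 𝒢.T, ∀ x,
      ∑ j ∈ Finset.univ.erase i, ‖playerDiff j (u i t) x‖ ≤ c)
    {t : ℝ} (ht : t ∈ Icc 0 𝒢.T) (i : Fin N) (x : Fin N → Fin d) :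
    |u i t x - v i t x| ≤ r * 𝒢.T * Real.exp (2 * L * √d * (1 + c) * 𝒢.T) := by
  refine abs_le_mul_exp_of_neg_le_deriv_at_max (isCompact_univ (X := Fin N × (Fin N → Fin d)))
    (f := fun t q => u q.1 t q.2 - v q.1 t q.2)
    (f' := fun t q => derivWithin (fun s => u q.1 s q.2) (Icc 0 𝒢.T) t
      - derivWithin (fun s => v q.1 s q.2) (Icc 0 𝒢.T) t) (by positivity) hr
    (continuousOn_of_contDiffOn_time
      (f := fun t (q : Fin N × (Fin N → Fin d)) => u q.1 t q.2 - v q.1 t q.2)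
      fun q => (hu q.1 q.2).sub (hv.contDiffOn_time q.1 q.2))
    (fun t ht q _ => (hasDerivWithinAt_of_contDiffOn (hu q.1 q.2) ht).sub
      (hasDerivWithinAt_of_contDiffOn (hv.contDiffOn_time q.1 q.2) ht))
    (fun q _ => sub_eq_zero.2 (hT q.1 q.2))
    (fun t ht ⟨i, x⟩ _ σ hσ hmax => ?_) t ht (i, x) (mem_univ _)
  have hmax' : ∀ j y, |u j t y - v j t y| ≤ σ * (u i t x - v i t x) :=
    fun j y => hmax (j, y) (mem_univ _)
  have hinter := sign_mul_interaction_sub_le hL (huK · t ht x) (hvK · t ht x)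
    (hcross i t ht x) hσ hmax'
  have hham : -(L * (√d * (2 * (σ * (u i t x - v i t x)))))
      ≤ σ * (𝒢.H (x i) (playerDiff i (u i t) x) - 𝒢.H (x i) (playerDiff i (v i t) x)) := by
    have hlip := (hL.abs_H_sub_le (x i) (huK i t ht x) (hvK i t ht x)).trans
      (mul_le_mul_of_nonneg_left (norm_playerDiff_sub_le hmax' i) L.coe_nonneg)
    rw [neg_le, ← mul_neg]
    exact (sign_mul_le_abs hσ _).trans (by rwa [abs_neg])
  have hru := (sign_mul_le_abs hσ _).trans (hres i t ht x)
  have hrv : σ * 𝒢.hjbResidual v i t x = 0 := by rw [hv.hjbResidual_eq_zero i ht x, mul_zero]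
  simp only [hjbResidual] at hru hrv
  linarith

end Stability

end Game

/-! ### Projections of the Master Equation -/

namespace Game

variable {d N : ℕ} {𝒢 : Game d} {U : ℝ → Fin d → Vec d → ℝ}
  {D : ℝ → Fin d → Vec d → Fin d → Vec d} {K c t : ℝ} {L : ℝ≥0}

theorem norm_playerDiff_projection_le (hexp : ∀ x, HasTransferExpansion (U t x) (D t x) c)
    (hc : 0 ≤ c) (hN : 2 ≤ N) {i j : Fin N} (hij : j ≠ i) (x : Fin N → Fin d) :
    ‖playerDiff j (projection N U i t) x‖ ≤ √d * (c * ((N : ℝ) - 1)⁻¹) := by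
  have hε := inv_pred_pos hN
  refine norm_le_sqrt_mul (by positivity) fun z => ?_
  rw [playerDiff_apply, projection, projection, Function.update_of_ne hij.symm]
  exact (hexp (x i)).abs_update_sub_le hc hN i x j z

theorem sum_norm_playerDiff_projection_le (hexp : ∀ x, HasTransferExpansion (U t x) (D t x) c)
    (hc : 0 ≤ c) (hN : 2 ≤ N) (i : Fin N) (x : Fin N → Fin d) :
    ∑ j ∈ Finset.univ.erase i, ‖playerDiff j (projection N U i t) x‖ ≤ √d * c := by
  refine (Finset.sum_le_card_nsmul _ _ _ fun j hj =>
    norm_playerDiff_projection_le hexp hc hN (Finset.ne_of_mem_erase hj) x).trans_eq ?_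
  rw [nsmul_eq_mul, mul_left_comm, mul_left_comm _ c, card_erase_mul_inv_pred hN, mul_one]

theorem norm_playerDiff_projection_sub_smul_le
    (hexp : ∀ x, HasTransferExpansion (U t x) (D t x) c) (hc : 0 ≤ c) (hN : 2 ≤ N)
    {i j : Fin N} (hij : j ≠ i) (x : Fin N → Fin d) :
    ‖playerDiff j (projection N U i t) x
      - ((N : ℝ) - 1)⁻¹ • D t (x i) (empiricalExcept i x) (x j)‖
      ≤ √d * (c * ((N : ℝ) - 1)⁻¹ ^ 2) := by
  refine norm_le_sqrt_mul (by positivity) fun z => ?_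
  have hmem := empiricalExcept_mem_simplex hN i (Function.update x j z)
  rw [empiricalExcept_update_of_ne hij] at hmem
  rw [PiLp.sub_apply, PiLp.smul_apply, smul_eq_mul, playerDiff_projection_of_ne U hij]
  exact (hexp (x i)).abs_sub_sub_le _ (empiricalExcept_mem_simplex hN i x) _ _ _
    ⟨(inv_pred_pos hN).le, inv_pred_le_one hN⟩ hmem

theorem norm_stateDiff_empiricalExcept_sub_le
    (hexp : ∀ x, HasTransferExpansion (U t x) (D t x) c) (hN : 2 ≤ N) (i j : Fin N)
    (x : Fin N → Fin d) (y : Fin d) :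
    ‖stateDiff (fun y => U t y (empiricalExcept i x)) y
      - stateDiff (fun y => U t y (empiricalExcept j x)) y‖
      ≤ √d * (2 * (c * ((N : ℝ) - 1)⁻¹)) := by
  rw [← stateDiff_sub]
  exact norm_stateDiff_le (fun y => (hexp y).abs_empiricalExcept_sub_le hN i j x) y

namespace IsClassicalSolution

theorem norm_playerDiff_projection_self_le (hU : 𝒢.IsClassicalSolution U D)
    (hK : 𝒢.IsAprioriRadius K) (hN : 2 ≤ N) (i : Fin N) (ht : t ∈ Icc 0 𝒢.T)
    (x : Fin N → Fin d) : ‖playerDiff i (projection N U i t) x‖ ≤ K := by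
  rw [playerDiff_projection_self]
  exact hU.norm_stateDiff_le hK ht (empiricalExcept_mem_simplex hN i x) (x i)

theorem hjbResidual_projection_eq (hU : 𝒢.IsClassicalSolution U D) (hN : 2 ≤ N) (i : Fin N)
    (ht : t ∈ Icc 0 𝒢.T) (x : Fin N → Fin d) :
    𝒢.hjbResidual (projection N U) i t x
      = ∑ j ∈ Finset.univ.erase i,
          (inner ℝ (𝒢.αstar (x j) (stateDiff (fun y => U t y (empiricalExcept i x)) (x j)))
              (((N : ℝ) - 1)⁻¹ • D t (x i) (empiricalExcept i x) (x j))
            - inner ℝ (𝒢.feedback (projection N U) j t x)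
              (playerDiff j (projection N U i t) x)) := by
  have hmaster := hU.equation t ht (x i) _ (empiricalExcept_mem_simplex hN i x)
  rw [sum_empiricalExcept_mul i x fun y => inner ℝ (D t (x i) (empiricalExcept i x) y)
    (𝒢.αstar y (stateDiff (fun z => U t z (empiricalExcept i x)) y))] at hmaster
  simp only [real_inner_smul_right, Finset.sum_sub_distrib, ← Finset.mul_sum]
  simp only [real_inner_comm (D t _ _ _)] at hmaster ⊢
  rw [hjbResidual, interaction, ← hmaster, playerDiff_projection_self]
  simp only [projection]
  ring

theorem abs_hjbResidual_projection_le (hU : 𝒢.IsClassicalSolution U D)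
    (hexp : ∀ x, HasTransferExpansion (U t x) (D t x) c) (hc : 0 ≤ c)
    (hK : 𝒢.IsAprioriRadius K) (hL : 𝒢.UniformH1 K L) (hN : 2 ≤ N) (i : Fin N)
    (ht : t ∈ Icc 0 𝒢.T) (x : Fin N → Fin d) :
    |𝒢.hjbResidual (projection N U) i t x|
      ≤ (2 * d * L * c ^ 2 + d * 𝒢.M * c) * ((N : ℝ) - 1)⁻¹ := by
  set ε := ((N : ℝ) - 1)⁻¹
  have hε : 0 < ε := inv_pred_pos hN
  have hM := 𝒢.M_pos
  set m := empiricalExcept i x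
  set a := fun j => 𝒢.αstar (x j) (stateDiff (fun y => U t y m) (x j))
  set b := fun j => 𝒢.feedback (projection N U) j t x
  set p := fun j => playerDiff j (projection N U i t) x
  set q := fun j => ε • D t (x i) m (x j)
  have hcontrol : ∀ j, ‖a j - b j‖ ≤ L * (√d * (2 * (c * ε))) := fun j => by
    have hbj : ‖a j - b j‖ ≤ L * ‖_ - _‖ := hL.norm_αstar_sub_le (x j)
      (hU.norm_stateDiff_le hK ht (empiricalExcept_mem_simplex hN i x) (x j))
      (hU.norm_playerDiff_projection_self_le hK hN j ht x)
    rw [playerDiff_projection_self] at hbj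
    exact hbj.trans (mul_le_mul_of_nonneg_left
      (norm_stateDiff_empiricalExcept_sub_le hexp hN i j x (x j)) L.coe_nonneg)
  have hq : ∀ j, ‖q j‖ ≤ √d * (c * ε) := fun j => norm_le_sqrt_mul (by positivity) fun z => by
    rw [PiLp.smul_apply, smul_eq_mul, abs_mul, abs_of_pos hε, mul_comm]
    exact mul_le_mul_of_nonneg_right
      ((hexp (x i)).abs_deriv_le m (empiricalExcept_mem_simplex hN i x) _ z) hε.le
  have hterm : ∀ j ∈ Finset.univ.erase i, |inner ℝ (a j) (q j) - inner ℝ (b j) (p j)|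
      ≤ (2 * d * L * c ^ 2 + d * 𝒢.M * c) * ε ^ 2 := fun j hj =>
    calc |inner ℝ (a j) (q j) - inner ℝ (b j) (p j)|
        ≤ ‖a j - b j‖ * ‖q j‖ + ‖b j‖ * ‖p j - q j‖ := abs_inner_sub_inner_le _ _ _ _
      _ ≤ L * (√d * (2 * (c * ε))) * (√d * (c * ε)) + √d * 𝒢.M * (√d * (c * ε ^ 2)) := by
          gcongr
          · exact hcontrol j
          · exact hq j
          · exact 𝒢.norm_αstar_le _ _
          · exact norm_playerDiff_projection_sub_smul_le hexp hc hN (Finset.ne_of_mem_erase hj) x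
      _ = (2 * L * c ^ 2 + 𝒢.M * c) * ε ^ 2 * (√d * √d) := by ring
      _ = (2 * d * L * c ^ 2 + d * 𝒢.M * c) * ε ^ 2 := by
          rw [Real.mul_self_sqrt d.cast_nonneg]; ring
  rw [hU.hjbResidual_projection_eq hN i ht x]
  refine (Finset.abs_sum_le_sum_abs _ _).trans ((Finset.sum_le_card_nsmul _ _ _ hterm).trans_eq ?_)
  rw [nsmul_eq_mul, pow_two ε, mul_left_comm, ← mul_assoc _ ε, card_erase_mul_inv_pred hN, one_mul]

end IsClassicalSolution

theorem exists_abs_projection_sub_le (hK : 𝒢.IsAprioriRadius K) (hH1 : 𝒢.H1 K)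
    (hU : 𝒢.IsRegularSolution U) : ∃ c : ℝ, 0 ≤ c ∧ ∀ N : ℕ, 2 ≤ N →
      ∀ v : Fin N → ℝ → (Fin N → Fin d) → ℝ, 𝒢.SolvesHJB v → ∀ t ∈ Icc 0 𝒢.T, ∀ i x,
        |projection N U i t x - v i t x| ≤ c / N := by
  obtain ⟨D, hD, c, hc, hexp⟩ := hU.exists_hasTransferExpansion
  obtain ⟨L, hL⟩ := hH1.exists_uniformH1
  have hM := 𝒢.M_pos
  have hT := 𝒢.T_pos
  set R := 2 * d * L * c ^ 2 + d * 𝒢.M * c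
  set E := Real.exp (2 * L * √d * (1 + √d * c) * 𝒢.T)
  have : 0 ≤ R := by positivity
  refine ⟨2 * R * 𝒢.T * E, by positivity, fun N hN v hv t ht i x => ?_⟩
  have hε := inv_pred_pos hN
  calc |projection N U i t x - v i t x| ≤ R * ((N : ℝ) - 1)⁻¹ * 𝒢.T * E :=
        abs_sub_le_of_abs_hjbResidual_le hL (by positivity) (by positivity)
          (fun i x => hD.contDiffOn_time (x i) _ (empiricalExcept_mem_simplex hN i x)) hv
          (fun i x => (hD.terminal _ _ (empiricalExcept_mem_simplex hN i x)).trans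
            (hv.terminal i x).symm)
          (fun i t ht x => hD.abs_hjbResidual_projection_le (hexp t ht) hc hK hL hN i ht x)
          (fun i t ht x => hD.norm_playerDiff_projection_self_le hK hN i ht x)
          (fun i t ht x => hv.norm_playerDiff_le hN hK i i ht x)
          (fun i t ht x => sum_norm_playerDiff_projection_le (hexp t ht) hc hN i x) ht i x
    _ ≤ R * (2 / N) * 𝒢.T * E := by gcongr; exact inv_pred_le_two_div hN
    _ = 2 * R * 𝒢.T * E / N := by ring

theorem exists_norm_feedback_sub_le (hK : 𝒢.IsAprioriRadius K) (hH1 : 𝒢.H1 K)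
    (hU : 𝒢.IsRegularSolution U) : ∃ ℓ : ℝ, 0 ≤ ℓ ∧ ∀ N : ℕ, 2 ≤ N →
      ∀ v : Fin N → ℝ → (Fin N → Fin d) → ℝ, 𝒢.SolvesHJB v → ∀ t ∈ Icc 0 𝒢.T,
        ∀ (i : Fin N) (x y : Fin N → Fin d), x i = y i →
        ‖𝒢.feedback v i t x - 𝒢.feedback (projection N U) i t y‖
          ≤ ℓ / N * (1 + hammingDist x y) := by
  obtain ⟨δ, hδ, hclose⟩ := exists_abs_projection_sub_le hK hH1 hU
  obtain ⟨D, hD, c, hc, hexp⟩ := hU.exists_hasTransferExpansion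
  obtain ⟨L, hL⟩ := hH1.exists_uniformH1
  refine ⟨L * √d * (2 * δ + 4 * c), by positivity, fun N hN v hv t ht i x y hxy => ?_⟩
  have hvalue : ‖playerDiff i (v i t) x - playerDiff i (projection N U i t) x‖
      ≤ √d * (2 * (δ / N)) := by
    rw [norm_sub_rev]
    exact norm_playerDiff_sub_le (fun j y => hclose N hN v hv t ht j y) i
  have hmeasure : ‖playerDiff i (projection N U i t) x - playerDiff i (projection N U i t) y‖
      ≤ √d * (2 * (c * ((N : ℝ) - 1)⁻¹ * hammingDist y x)) := by
    rw [playerDiff_projection_self, playerDiff_projection_self, hxy, ← stateDiff_sub]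
    exact norm_stateDiff_le (fun z => abs_sub_le_mul_hammingDist
      (g := fun x => U t z (empiricalExcept i x))
      (fun x j w => (hexp t ht z).abs_update_sub_le hc hN i x j w) y x) (y i)
  have hrate := hL.norm_αstar_sub_le (x i) (hv.norm_playerDiff_le hN hK i i ht x)
    (hD.norm_playerDiff_projection_self_le hK hN i ht y)
  rw [feedback, feedback, ← hxy]
  calc _ ≤ L * (√d * (2 * (δ / N)) + √d * (2 * (c * (2 / N) * hammingDist x y))) := by
        refine hrate.trans (mul_le_mul_of_nonneg_left ?_ L.coe_nonneg)
        refine (norm_sub_le_norm_sub_add_norm_sub _ _ _).trans (add_le_add hvalue ?_)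
        rw [hammingDist_comm] at hmeasure
        refine hmeasure.trans ?_
        gcongr
        exact inv_pred_le_two_div hN
    _ = L * √d / N * (2 * δ + 4 * c * hammingDist x y) := by ring
    _ ≤ L * √d / N * ((2 * δ + 4 * c) * (1 + hammingDist x y)) := by
        gcongr
        nlinarith [mul_nonneg hδ (hammingDist x y).cast_nonneg (α := ℝ)]
    _ = L * √d * (2 * δ + 4 * c) / N * (1 + hammingDist x y) := by ring

end Game

/-! ### Upper integrals -/

section UpperIntegral

variable {Ω : Type*} {mΩ : MeasurableSpace Ω} {P : Measure Ω} {f g : Ω → ℝ≥0∞} {r s : ℝ≥0∞}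

/-- The upper integral of `f` is at most `r`.  The suprema over time to be estimated are not known
to be measurable; unlike `∫⁻`, which is a lower integral, the upper integral is subadditive on
arbitrary functions. -/
def UpperIntegralLE (P : Measure Ω) (f : Ω → ℝ≥0∞) (r : ℝ≥0∞) : Prop :=
  ∃ R : Ω → ℝ≥0∞, Measurable R ∧ f ≤ᵐ[P] R ∧ ∫⁻ ω, R ω ∂P ≤ r

namespace UpperIntegralLE

theorem of_measurable (hf : Measurable f) (hr : ∫⁻ ω, f ω ∂P ≤ r) : UpperIntegralLE P f r :=
  ⟨f, hf, EventuallyLE.rfl, hr⟩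

theorem lintegral_le (h : UpperIntegralLE P f r) : ∫⁻ ω, f ω ∂P ≤ r :=
  let ⟨_, _, hfR, hR⟩ := h
  (lintegral_mono_ae hfR).trans hR

theorem mono (h : UpperIntegralLE P f r) (hgf : g ≤ᵐ[P] f) (hrs : r ≤ s) :
    UpperIntegralLE P g s :=
  let ⟨R, hRm, hfR, hR⟩ := h
  ⟨R, hRm, hgf.trans hfR, hR.trans hrs⟩

theorem add (hf : UpperIntegralLE P f r) (hg : UpperIntegralLE P g s) :
    UpperIntegralLE P (fun ω => f ω + g ω) (r + s) :=
  let ⟨R, hRm, hfR, hR⟩ := hf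
  let ⟨Q, hQm, hgQ, hQ⟩ := hg
  ⟨fun ω => R ω + Q ω, hRm.add hQm,
    by filter_upwards [hfR, hgQ] with ω hf hg using add_le_add hf hg,
    (lintegral_add_left hRm Q).trans_le (add_le_add hR hQ)⟩

theorem sum {ι : Type*} {I : Finset ι} {f : ι → Ω → ℝ≥0∞} {r : ι → ℝ≥0∞}
    (h : ∀ i ∈ I, UpperIntegralLE P (f i) (r i)) :
    UpperIntegralLE P (fun ω => ∑ i ∈ I, f i ω) (∑ i ∈ I, r i) := by
  classical
  induction I using Finset.induction_on with
  | empty => exact of_measurable (by simp) (by simp)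
  | insert i I hi ih =>
    simp only [Finset.sum_insert hi]
    exact (h i (I.mem_insert_self i)).add (ih fun j hj => h j (Finset.mem_insert_of_mem hj))

theorem const_mul (h : UpperIntegralLE P f r) (c : ℝ≥0∞) :
    UpperIntegralLE P (fun ω => c * f ω) (c * r) :=
  let ⟨R, hRm, hfR, hR⟩ := h
  ⟨fun ω => c * R ω, hRm.const_mul c, by filter_upwards [hfR] with ω h using mul_le_mul_right h c,
    (lintegral_const_mul c hRm).trans_le (by gcongr)⟩

theorem liminf {f : ℕ → Ω → ℝ≥0∞} (h : ∀ n, UpperIntegralLE P (f n) r) :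
    UpperIntegralLE P (fun ω => liminf (fun n => f n ω) atTop) r := by
  choose R hRm hfR hR using h
  refine ⟨fun ω => Filter.liminf (fun n => R n ω) atTop, .liminf hRm, ?_, ?_⟩
  · filter_upwards [ae_all_iff.2 hfR] with ω hω
    exact liminf_le_liminf (Eventually.of_forall hω)
  · exact (lintegral_liminf_le hRm).trans
      (liminf_le_of_frequently_le' (Frequently.of_forall hR))

end UpperIntegralLE

end UpperIntegral

/-! ### Compensation of random measures -/

theorem lintegral_natCast_poissonMeasure (r : ℝ≥0) :
    ∫⁻ n : ℕ, (n : ℝ≥0∞) ∂(poissonMeasure r) = r := by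
  have hterm : ∀ n : ℕ, ENNReal.ofReal (Real.exp (-r) * r ^ (n + 1) / ((n + 1).factorial : ℝ))
      * ((n + 1 : ℕ) : ℝ≥0∞)
      = r * ENNReal.ofReal (Real.exp (-r) * r ^ n / (n.factorial : ℝ)) := by
    intro n
    rw [← ENNReal.ofReal_natCast, ← ENNReal.ofReal_mul (by positivity),
      ← ENNReal.ofReal_coe_nnreal, ← ENNReal.ofReal_mul (by positivity), Nat.factorial_succ]
    congr 1
    push_cast
    field_simp
    exact pow_succ' _ _
  calc ∫⁻ n : ℕ, (n : ℝ≥0∞) ∂(poissonMeasure r)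
      = ∑' n : ℕ, ENNReal.ofReal (Real.exp (-r) * r ^ n / (n.factorial : ℝ)) * n := by
        simp only [poissonMeasure, lintegral_sum_measure, lintegral_smul_measure, lintegral_dirac,
          smul_eq_mul]
    _ = ∑' n : ℕ, r * ENNReal.ofReal (Real.exp (-r) * r ^ n / (n.factorial : ℝ)) := by
        rw [tsum_eq_zero_add' ENNReal.summable]
        simp only [hterm, Nat.cast_zero, mul_zero, zero_add]
    _ = r := by
        rw [ENNReal.tsum_mul_left, ← ENNReal.ofReal_tsum_of_nonneg (fun n => by positivity)
          (hasSum_one_poissonMeasure r).summable, (hasSum_one_poissonMeasure r).tsum_eq,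
          ENNReal.ofReal_one, mul_one]

theorem IsPoissonRandomMeasure.bind_eq {Ω S : Type*} [MeasurableSpace Ω] [MeasurableSpace S]
    {P : Measure Ω} {μ : Measure S} [IsFiniteMeasure μ] {𝒩 : Ω → Measure S}
    (h : IsPoissonRandomMeasure P μ 𝒩) : P.bind 𝒩 = μ := by
  ext B hB
  have hm : Measurable fun ω => 𝒩 ω B := (Measure.measurable_coe hB).comp h.measurable
  calc P.bind 𝒩 B = ∫⁻ r, r ∂(P.map fun ω => 𝒩 ω B) := by
        rw [Measure.bind_apply hB h.measurable.aemeasurable, lintegral_map measurable_id' hm]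
    _ = ∫⁻ n : ℕ, (n : ℝ≥0∞) ∂(poissonMeasure (μ B).toNNReal) := by
        rw [h.law B hB (measure_ne_top μ B), lintegral_map measurable_id' (by fun_prop)]
    _ = μ B := by
        rw [lintegral_natCast_poissonMeasure, ENNReal.coe_toNNReal (measure_ne_top μ B)]

/-- The largest multiple of `1 / (n + 1)` strictly below `s`, for `s > 0`. -/
def gridBefore (n : ℕ) (s : ℝ) : ℝ := ((⌈s * (n + 1)⌉₊ : ℝ) - 1) / (n + 1)

theorem gridBefore_mem_Ico (n : ℕ) {s : ℝ} (hs : 0 < s) : gridBefore n s ∈ Ico 0 s := by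
  have hpos : 0 < s * (n + 1) := by positivity
  have hceil : (1 : ℝ) ≤ ⌈s * (n + 1)⌉₊ := by exact_mod_cast Nat.ceil_pos.2 hpos
  refine ⟨div_nonneg (sub_nonneg.2 hceil) (by positivity), (div_lt_iff₀ (by positivity)).2 ?_⟩
  linarith [Nat.ceil_lt_add_one hpos.le]

theorem tendsto_gridBefore {s : ℝ} (hs : 0 < s) :
    Tendsto (fun n => gridBefore n s) atTop (𝓝[<] s) := by
  refine tendsto_nhdsWithin_iff.2
    ⟨?_, Eventually.of_forall fun n => (gridBefore_mem_Ico n hs).2⟩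
  have hlim : Tendsto (fun n : ℕ => s - 1 / ((n : ℝ) + 1)) atTop (𝓝 s) := by
    simpa only [sub_zero] using tendsto_one_div_add_atTop_nhds_zero_nat.const_sub s
  refine tendsto_of_tendsto_of_tendsto_of_le_of_le hlim tendsto_const_nhds (fun n => ?_)
    fun n => (gridBefore_mem_Ico n hs).2.le
  have hn : (n : ℝ) + 1 ≠ 0 := by positivity
  calc s - 1 / ((n : ℝ) + 1) = (s * (n + 1) - 1) / (n + 1) := by field_simp
    _ ≤ gridBefore n s := by unfold gridBefore; gcongr; exact Nat.le_ceil _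

theorem measurable_comp_gridBefore {E F S : Type*} [MeasurableSpace E] [MeasurableSpace F]
    [Countable S] [MeasurableSpace S] [DiscreteMeasurableSpace S] (n : ℕ) (Z : ℝ → S)
    {f : S → ℝ × E → F} (hf : ∀ c, Measurable (f c)) :
    Measurable fun p : ℝ × E => f (Z (gridBefore n p.1)) p := by
  have hceil : Measurable fun p : ℝ × E => ⌈p.1 * (n + 1)⌉₊ :=
    Nat.measurable_ceil.comp (measurable_fst.mul_const _)
  exact (measurable_from_prod_countable_right (f := fun q : S × ℝ × E => f q.1 q.2) hf).comp
    (((measurable_from_nat (f := fun k => Z (((k : ℝ) - 1) / (n + 1)))).comp hceil).prodMk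
      measurable_id)

theorem aemeasurable_comp_leftLim {E S : Type*} [MeasurableSpace E] [Countable S]
    [MeasurableSpace S] [DiscreteMeasurableSpace S] {φ φl : ℝ → S} {t : ℝ}
    (hφ : ∀ s ∈ Ioc 0 t, ∀ᶠ r in 𝓝[<] s, φ r = φl s) {f : S → ℝ × E → ℝ}
    (hf : ∀ c, Measurable (f c)) (μ : Measure (ℝ × E)) :
    AEMeasurable (fun p => f (φl p.1) p) (μ.restrict (Ioc 0 t ×ˢ univ)) := by
  refine aemeasurable_of_tendsto_metrizable_ae atTop
    (fun n => (measurable_comp_gridBefore n φ hf).aemeasurable) ?_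
  filter_upwards [ae_restrict_mem (measurableSet_Ioc.prod .univ)] with p hp
  refine tendsto_const_nhds.congr' ?_
  filter_upwards [(tendsto_gridBefore hp.1.1).eventually (hφ p.1 hp.1)] with n hn
  rw [hn]

/-- A random measure on `ℝ × E` with mean measure `μ` whose restriction to the times after `s` is
independent of `𝓕 s`, for all `s ∈ [0, T]`. Apart from its intensity, this is all the coupling
argument needs of a Poisson random measure. -/
structure IsForwardNoise {Ω E : Type*} {mΩ : MeasurableSpace Ω} [MeasurableSpace E]
    (P : Measure Ω) (𝓕 : Filtration ℝ mΩ) (T : ℝ) (μ : Measure (ℝ × E))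
    (𝒩 : Ω → Measure (ℝ × E)) : Prop where
  measurable : Measurable 𝒩
  bind_eq : P.bind 𝒩 = μ
  indep_future : ∀ s ∈ Icc 0 T, Indep (𝓕 s)
    (MeasurableSpace.comap (fun ω => (𝒩 ω).restrict (Ioi s ×ˢ univ)) inferInstance) P

namespace IsForwardNoise

variable {Ω E S : Type*} {mΩ : MeasurableSpace Ω} [MeasurableSpace E] {P : Measure Ω}
  {𝓕 : Filtration ℝ mΩ} {T : ℝ} {μ : Measure (ℝ × E)} {𝒩 : Ω → Measure (ℝ × E)}

theorem lintegral_lintegral (h𝒩 : IsForwardNoise P 𝓕 T μ 𝒩) {f : ℝ × E → ℝ≥0∞}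
    (hf : Measurable f) : ∫⁻ ω, ∫⁻ p, f p ∂(𝒩 ω) ∂P = ∫⁻ p, f p ∂μ := by
  rw [← h𝒩.bind_eq, Measure.lintegral_bind h𝒩.measurable.aemeasurable hf.aemeasurable]

theorem ae_lt_top [IsFiniteMeasure μ] (h𝒩 : IsForwardNoise P 𝓕 T μ 𝒩) :
    ∀ᵐ ω ∂P, 𝒩 ω univ < ∞ := by
  refine MeasureTheory.ae_lt_top
    ((Measure.measurable_coe MeasurableSet.univ).comp h𝒩.measurable) ?_
  rw [← Measure.bind_apply MeasurableSet.univ h𝒩.measurable.aemeasurable, h𝒩.bind_eq]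
  exact measure_ne_top μ univ

variable [Countable S] [MeasurableSpace S] [DiscreteMeasurableSpace S]

theorem measurable_setLIntegral (h𝒩 : IsForwardNoise P 𝓕 T μ 𝒩) {Y : Ω → S}
    (hY : Measurable Y) {B : Set (ℝ × E)} (hB : MeasurableSet B) {f : S → ℝ × E → ℝ≥0∞}
    (hf : ∀ c, Measurable (f c)) : Measurable fun ω => ∫⁻ p in B, f (Y ω) p ∂(𝒩 ω) := by
  simp only [← lintegral_indicator hB]
  exact (measurable_from_prod_countable_right
    (f := fun q : S × Measure (ℝ × E) => ∫⁻ p, B.indicator (f q.1) p ∂q.2) fun c =>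
      Measure.measurable_lintegral ((hf c).indicator hB)).comp (hY.prodMk h𝒩.measurable)

variable [IsProbabilityMeasure P]

theorem lintegral_setLIntegral_future (h𝒩 : IsForwardNoise P 𝓕 T μ 𝒩) {s : ℝ}
    (hs : s ∈ Icc 0 T) {Y : Ω → S} (hY : Measurable[𝓕 s] Y) {B : Set (ℝ × E)}
    (hB : MeasurableSet B) (hBs : B ⊆ Ioi s ×ˢ univ) {f : S → ℝ × E → ℝ≥0∞}
    (hf : ∀ c, Measurable (f c)) :
    ∫⁻ ω, ∫⁻ p in B, f (Y ω) p ∂(𝒩 ω) ∂P = ∫⁻ ω, ∫⁻ p in B, f (Y ω) p ∂μ ∂P := by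
  have hYm : Measurable Y := hY.mono (𝓕.le s) le_rfl
  let ρ : Ω → Measure (ℝ × E) := fun ω => (𝒩 ω).restrict (Ioi s ×ˢ univ)
  have hρ : Measurable ρ := Measure.measurable_of_measurable_coe _ fun B hB => by
    simp only [ρ, Measure.restrict_apply hB]
    exact (Measure.measurable_coe (hB.inter (measurableSet_Ioi.prod .univ))).comp h𝒩.measurable
  have hindep : IndepFun Y ρ P :=
    (IndepFun_iff_Indep Y ρ P).2 (indep_of_indep_of_le_left (h𝒩.indep_future s hs) hY.comap_le)
  let g : S × Measure (ℝ × E) → ℝ≥0∞ := fun q => ∫⁻ p, B.indicator (f q.1) p ∂q.2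
  have hg : Measurable g :=
    measurable_from_prod_countable_right fun c => Measure.measurable_lintegral ((hf c).indicator hB)
  have hgρ : ∀ c ω, g (c, ρ ω) = ∫⁻ p in B, f c p ∂(𝒩 ω) := fun c ω => by
    simp only [g, ρ]
    rw [lintegral_indicator hB, Measure.restrict_restrict hB, inter_eq_self_of_subset_left hBs]
  calc ∫⁻ ω, ∫⁻ p in B, f (Y ω) p ∂(𝒩 ω) ∂P
      = ∫⁻ q, g q ∂(P.map fun ω => (Y ω, ρ ω)) := by
        simp only [lintegral_map hg (hYm.prodMk hρ), hgρ]
    _ = ∫⁻ ω, ∫⁻ ω', g (Y ω, ρ ω') ∂P ∂P := by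
        have := Measure.isProbabilityMeasure_map (μ := P) hρ.aemeasurable
        rw [(indepFun_iff_map_prod_eq_prod_map_map hYm.aemeasurable hρ.aemeasurable).1 hindep,
          lintegral_prod _ hg.aemeasurable, lintegral_map hg.lintegral_prod_right' hYm]
        exact lintegral_congr fun ω => lintegral_map (hg.comp measurable_prodMk_left) hρ
    _ = ∫⁻ ω, ∫⁻ p in B, f (Y ω) p ∂μ ∂P := by
        simp only [hgρ, ← lintegral_indicator hB, h𝒩.lintegral_lintegral ((hf _).indicator hB)]

variable {ν : Measure E} [SFinite ν]

theorem lintegral_setLIntegral_le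
    (h𝒩 : IsForwardNoise P 𝓕 T ((volume.restrict (Icc 0 T)).prod ν) 𝒩) {r : ℝ} (hr : r ∈ Icc 0 T)
    {Y : Ω → S} (hY : Measurable[𝓕 r] Y) {J : Set ℝ} (hJ : MeasurableSet J) (hJr : J ⊆ Ioc r T)
    {f : S → ℝ × E → ℝ≥0∞} (hf : ∀ c, Measurable (f c)) {b : ℝ → ℝ≥0∞}
    (hb : ∀ s ∈ J, ∫⁻ ω, ∫⁻ ξ, f (Y ω) (s, ξ) ∂ν ∂P ≤ b s) :
    ∫⁻ ω, ∫⁻ p in J ×ˢ univ, f (Y ω) p ∂(𝒩 ω) ∂P ≤ ∫⁻ s in J, b s := by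
  have hm : Measurable fun q : (Ω × ℝ) × E => f (Y q.1.1) (q.1.2, q.2) :=
    (measurable_from_prod_countable_right (f := fun q : S × ℝ × E => f q.1 q.2) hf).comp
      (((hY.mono (𝓕.le r) le_rfl).comp (measurable_fst.comp measurable_fst)).prodMk
        ((measurable_snd.comp measurable_fst).prodMk measurable_snd))
  calc ∫⁻ ω, ∫⁻ p in J ×ˢ univ, f (Y ω) p ∂(𝒩 ω) ∂P
      = ∫⁻ ω, (∫⁻ s in J, ∫⁻ ξ, f (Y ω) (s, ξ) ∂ν) ∂P := by
        rw [h𝒩.lintegral_setLIntegral_future hr hY (hJ.prod .univ)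
          (prod_mono (hJr.trans Ioc_subset_Ioi_self) subset_rfl) hf]
        refine lintegral_congr fun ω => ?_
        rw [← Measure.prod_restrict, Measure.restrict_univ, Measure.restrict_restrict hJ,
          inter_eq_self_of_subset_left (hJr.trans (Ioc_subset_Icc_self.trans
            (Icc_subset_Icc_left hr.1))), lintegral_prod _ (hf _).aemeasurable]
    _ = ∫⁻ s in J, ∫⁻ ω, ∫⁻ ξ, f (Y ω) (s, ξ) ∂ν ∂P :=
        lintegral_lintegral_swap (f := fun ω s => ∫⁻ ξ, f (Y ω) (s, ξ) ∂ν)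
          hm.lintegral_prod_right'.aemeasurable
    _ ≤ ∫⁻ s in J, b s := setLIntegral_mono' hJ hb

theorem upperIntegralLE_setLIntegral_comp
    (h𝒩 : IsForwardNoise P 𝓕 T ((volume.restrict (Icc 0 T)).prod ν) 𝒩)
    {Z : ℝ → Ω → S} (hZ : ∀ t ∈ Icc 0 T, Measurable[𝓕 t] (Z t)) {f : S → ℝ × E → ℝ≥0∞}
    (hf : ∀ c, Measurable (f c)) {t : ℝ} (htT : t ≤ T) {b : ℝ → ℝ≥0∞}
    (hb : ∀ r s, 0 ≤ r → r < s → s ≤ t → ∫⁻ ω, ∫⁻ ξ, f (Z r ω) (s, ξ) ∂ν ∂P ≤ b s)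
    {κ : ℝ → ℕ} (hκ : Measurable κ) {a : ℕ → ℝ} (ha : ∀ s ∈ Ioc 0 t, a (κ s) ∈ Ico 0 s) :
    UpperIntegralLE P (fun ω => ∫⁻ p in Ioc 0 t ×ˢ univ, f (Z (a (κ p.1)) ω) p ∂(𝒩 ω))
      (∫⁻ s in Ioc 0 t, b s) := by
  let J : ℕ → Set ℝ := fun k => Ioc 0 t ∩ κ ⁻¹' {k}
  have hJ : ∀ k, MeasurableSet (J k) := fun k => measurableSet_Ioc.inter (hκ (.singleton k))
  have hJd : Pairwise (Function.onFun Disjoint J) := fun k l hkl =>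
    ((disjoint_singleton.2 hkl).preimage κ).mono inter_subset_right inter_subset_right
  have hJu : ⋃ k, J k = Ioc 0 t := by
    rw [← inter_iUnion, ← preimage_iUnion, iUnion_of_singleton, preimage_univ, inter_univ]
  have hsplit : ∀ ω, ∫⁻ p in Ioc 0 t ×ˢ univ, f (Z (a (κ p.1)) ω) p ∂(𝒩 ω)
      = ∑' k, ∫⁻ p in J k ×ˢ univ, f (Z (a k) ω) p ∂(𝒩 ω) := fun ω => by
    rw [← hJu, iUnion_prod_const, lintegral_iUnion (fun k => (hJ k).prod .univ)
      fun k l hkl => (hJd hkl).set_prod_left _ _]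
    refine tsum_congr fun k => setLIntegral_congr_fun ((hJ k).prod .univ) fun p hp => ?_
    rw [show κ p.1 = k from hp.1.2]
  have hcell : ∀ k, Measurable (fun ω => ∫⁻ p in J k ×ˢ univ, f (Z (a k) ω) p ∂(𝒩 ω))
      ∧ ∫⁻ ω, ∫⁻ p in J k ×ˢ univ, f (Z (a k) ω) p ∂(𝒩 ω) ∂P ≤ ∫⁻ s in J k, b s := fun k => by
    rcases (J k).eq_empty_or_nonempty with hk | ⟨s₀, hs₀, rfl⟩
    · simp [hk]
    have hr : a (κ s₀) ∈ Icc 0 T := ⟨(ha s₀ hs₀).1, (ha s₀ hs₀).2.le.trans (hs₀.2.trans htT)⟩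
    have hlt : ∀ s ∈ J (κ s₀), a (κ s₀) < s := fun s hs => by
      rw [← show κ s = κ s₀ from hs.2]
      exact (ha s hs.1).2
    exact ⟨(h𝒩.measurable_setLIntegral ((hZ _ hr).mono (𝓕.le _) le_rfl) ((hJ _).prod .univ)
      hf), h𝒩.lintegral_setLIntegral_le hr (hZ _ hr) (hJ _)
        (fun s hs => ⟨hlt s hs, hs.1.2.trans htT⟩) hf
        fun s hs => hb _ s hr.1 (hlt s hs) hs.1.2⟩
  simp only [hsplit]
  refine .of_measurable (.tsum fun k => (hcell k).1) ?_
  calc ∫⁻ ω, ∑' k, ∫⁻ p in J k ×ˢ univ, f (Z (a k) ω) p ∂(𝒩 ω) ∂P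
      = ∑' k, ∫⁻ ω, ∫⁻ p in J k ×ˢ univ, f (Z (a k) ω) p ∂(𝒩 ω) ∂P :=
        lintegral_tsum fun k => (hcell k).1.aemeasurable
    _ ≤ ∑' k, ∫⁻ s in J k, b s := ENNReal.tsum_le_tsum fun k => (hcell k).2
    _ = ∫⁻ s in Ioc 0 t, b s := by rw [← lintegral_iUnion hJ hJd, hJu]

/-- The left limits are approximated by the values at the previous points of finer and finer
grids, and both sides pass to the limit by Fatou's lemma. -/
theorem upperIntegralLE_setLIntegral_leftLim
    (h𝒩 : IsForwardNoise P 𝓕 T ((volume.restrict (Icc 0 T)).prod ν) 𝒩)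
    {Z Zl : ℝ → Ω → S} (hZ : ∀ t ∈ Icc 0 T, Measurable[𝓕 t] (Z t))
    (hZl : ∀ ω, ∀ s ∈ Ioc 0 T, ∀ᶠ r in 𝓝[<] s, Z r ω = Zl s ω) {f : S → ℝ × E → ℝ≥0∞}
    (hf : ∀ c, Measurable (f c)) {t : ℝ} (htT : t ≤ T) {b : ℝ → ℝ≥0∞}
    (hb : ∀ r s, 0 ≤ r → r < s → s ≤ t → ∫⁻ ω, ∫⁻ ξ, f (Z r ω) (s, ξ) ∂ν ∂P ≤ b s) :
    UpperIntegralLE P (fun ω => ∫⁻ p in Ioc 0 t ×ˢ univ, f (Zl p.1 ω) p ∂(𝒩 ω))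
      (∫⁻ s in Ioc 0 t, b s) := by
  have hgrid : ∀ n, UpperIntegralLE P
      (fun ω => ∫⁻ p in Ioc 0 t ×ˢ univ, f (Z (gridBefore n p.1) ω) p ∂(𝒩 ω))
      (∫⁻ s in Ioc 0 t, b s) := fun n =>
    h𝒩.upperIntegralLE_setLIntegral_comp (a := fun k => ((k : ℝ) - 1) / (n + 1)) hZ hf htT hb
      (Nat.measurable_ceil.comp (measurable_id.mul_const _)) fun s hs => gridBefore_mem_Ico n hs.1
  refine (UpperIntegralLE.liminf hgrid).mono (Eventually.of_forall fun ω => ?_) le_rfl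
  calc ∫⁻ p in Ioc 0 t ×ˢ univ, f (Zl p.1 ω) p ∂(𝒩 ω)
      ≤ ∫⁻ p in Ioc 0 t ×ˢ univ, liminf (fun n => f (Z (gridBefore n p.1) ω) p) atTop ∂(𝒩 ω) := by
        refine setLIntegral_mono' (measurableSet_Ioc.prod .univ) fun p hp => ?_
        refine le_liminf_of_le (by isBoundedDefault) ?_
        filter_upwards [(tendsto_gridBefore hp.1.1).eventually
          (hZl ω p.1 ⟨hp.1.1, hp.1.2.trans htT⟩)] with n hn
        rw [hn]
    _ ≤ liminf (fun n => ∫⁻ p in Ioc 0 t ×ˢ univ, f (Z (gridBefore n p.1) ω) p ∂(𝒩 ω)) atTop :=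
        lintegral_liminf_le fun n => measurable_comp_gridBefore n (Z · ω) hf

end IsForwardNoise

/-! ### Jumps and their intensity -/

section Jumps

variable {d : ℕ}

theorem abs_label_sub_le (x y : Fin d) : |label x - label y| ≤ d := by
  have hx : ((x : ℕ) : ℝ) ≤ d := by exact_mod_cast x.2.le
  have hy : ((y : ℕ) : ℝ) ≤ d := by exact_mod_cast y.2.le
  rw [label, label, add_sub_add_right_eq_sub]
  exact abs_sub_le_of_nonneg_of_le (Nat.cast_nonneg _) hx (Nat.cast_nonneg _) hy

theorem one_le_abs_label_sub {x y : Fin d} (h : x ≠ y) : 1 ≤ |label x - label y| := by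
  have hxy : ((x : ℕ) : ℤ) - ((y : ℕ) : ℤ) ≠ 0 := by
    rw [sub_ne_zero]
    exact_mod_cast Fin.val_ne_of_ne h
  rw [label, label, add_sub_add_right_eq_sub]
  exact_mod_cast Int.one_le_abs hxy

theorem abs_jump_le (x : Fin d) (ξ a : Vec d) : |jump x ξ a| ≤ (d : ℝ) ^ 2 := by
  have hterm : ∀ y, |(label y - label x) * indicator (Ioo 0 (a y)) (fun _ => (1 : ℝ)) (ξ y)|
      ≤ d := fun y => by
    have hind : |indicator (Ioo 0 (a y)) (fun _ => (1 : ℝ)) (ξ y)| ≤ 1 := by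
      by_cases h : ξ y ∈ Ioo 0 (a y) <;> simp [h]
    rw [abs_mul]
    exact (mul_le_of_le_one_right (abs_nonneg _) hind).trans (abs_label_sub_le y x)
  calc |jump x ξ a| ≤ ∑ _y : Fin d, (d : ℝ) :=
        (Finset.abs_sum_le_sum_abs _ _).trans (Finset.sum_le_sum fun y _ => hterm y)
    _ = (d : ℝ) ^ 2 := by
        rw [Finset.sum_const, Finset.card_univ, Fintype.card_fin, nsmul_eq_mul, sq]

theorem measurable_jump {α : Type*} [MeasurableSpace α] (x : Fin d) {ξ a : α → Vec d}
    (hξ : Measurable ξ) (ha : Measurable a) : Measurable fun p => jump x (ξ p) (a p) := by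
  refine Finset.measurable_sum _ fun y _ => Measurable.const_mul ?_ _
  have hind : (fun p => indicator (Ioo 0 (a p y)) (fun _ => (1 : ℝ)) (ξ p y))
      = indicator ({p | 0 < ξ p y} ∩ {p | ξ p y < a p y}) fun _ => (1 : ℝ) := by
    ext p
    simp only [indicator, mem_Ioo, mem_inter_iff, mem_ofPred_eq]
  rw [hind]
  exact measurable_const.indicator ((measurableSet_lt measurable_const (by fun_prop)).inter
    (measurableSet_lt (by fun_prop) (by fun_prop)))

theorem jump_single (x j : Fin d) (r : ℝ) (a : Vec d) :
    jump x (EuclideanSpace.single j r) a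
      = (label j - label x) * indicator (Ioo 0 (a j)) (fun _ => (1 : ℝ)) r := by
  rw [jump, Finset.sum_eq_single j (fun y _ hy => by simp [hy]) (by simp)]
  simp

variable {M : ℝ}

theorem lintegral_markIntensity {f : Vec d → ℝ≥0∞} (hf : Measurable f) :
    ∫⁻ ξ, f ξ ∂(markIntensity d M)
      = ∑ j : Fin d, ∫⁻ r in Icc 0 M, f (EuclideanSpace.single j r) := by
  have hsingle : ∀ j : Fin d, Measurable fun r : ℝ => (EuclideanSpace.single j r : Vec d) :=
    fun j => ((PiLp.continuous_toLp 2 (fun _ : Fin d => ℝ)).comp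
      (continuous_single (A := fun _ : Fin d => ℝ) j)).measurable
  rw [markIntensity, lintegral_finsetSum_measure]
  exact Finset.sum_congr rfl fun j _ => lintegral_map hf (hsingle j)

theorem markIntensity_univ (d : ℕ) (M : ℝ) :
    markIntensity d M univ = ENNReal.ofReal (d * M) := by
  calc markIntensity d M univ = ∫⁻ _, 1 ∂(markIntensity d M) := lintegral_one.symm
    _ = ENNReal.ofReal (d * M) := by
      rw [lintegral_markIntensity measurable_const, ENNReal.ofReal_mul d.cast_nonneg]
      simp

instance isFiniteMeasure_markIntensity (d : ℕ) (M : ℝ) : IsFiniteMeasure (markIntensity d M) :=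
  ⟨(markIntensity_univ d M).trans_lt ENNReal.ofReal_lt_top⟩

instance isFiniteMeasure_noiseIntensity (d : ℕ) (T M : ℝ) :
    IsFiniteMeasure (noiseIntensity d T M) := by
  unfold noiseIntensity; infer_instance

theorem lintegral_enorm_indicator_Ioo_sub_le (a b : ℝ) :
    ∫⁻ r, ‖indicator (Ioo 0 a) (fun _ => (1 : ℝ)) r - indicator (Ioo 0 b) (fun _ => (1 : ℝ)) r‖ₑ
      ≤ ENNReal.ofReal |a - b| := by
  wlog hab : a ≤ b generalizing a b
  · simpa only [enorm_sub_rev, abs_sub_comm] using this b a (le_of_not_ge hab)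
  have hIco : ∀ r, ‖indicator (Ioo 0 a) (fun _ => (1 : ℝ)) r
      - indicator (Ioo 0 b) (fun _ => (1 : ℝ)) r‖ₑ ≤ (Ico a b).indicator 1 r := fun r => by
    by_cases ha : r ∈ Ioo 0 a
    · simp [ha, Ioo_subset_Ioo_right hab ha]
    by_cases hb : r ∈ Ioo 0 b
    · simp [ha, hb, show r ∈ Ico a b from ⟨le_of_not_gt fun h => ha ⟨hb.1, h⟩, hb.2⟩]
    · simp [ha, hb]
  calc _ ≤ ∫⁻ r, (Ico a b).indicator 1 r := lintegral_mono hIco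
    _ = ENNReal.ofReal |a - b| := by
        rw [lintegral_indicator_one measurableSet_Ico, Real.volume_Ico, abs_sub_comm,
          abs_of_nonneg (sub_nonneg.2 hab)]

theorem lintegral_enorm_jump_sub_le (x : Fin d) (a b : Vec d) :
    ∫⁻ ξ, ‖jump x ξ a - jump x ξ b‖ₑ ∂(markIntensity d M)
      ≤ ENNReal.ofReal ((d : ℝ) ^ 2 * ‖a - b‖) := by
  have hm : Measurable fun ξ : Vec d => ‖jump x ξ a - jump x ξ b‖ₑ :=
    ((measurable_jump x measurable_id measurable_const).sub
      (measurable_jump x measurable_id measurable_const)).enorm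
  have haxis : ∀ j : Fin d, ∫⁻ r in Icc 0 M, ‖jump x (EuclideanSpace.single j r) a
      - jump x (EuclideanSpace.single j r) b‖ₑ ≤ ENNReal.ofReal (d * ‖a - b‖) := fun j => by
    have hlabel : ‖label j - label x‖ₑ ≤ ENNReal.ofReal d := by
      rw [Real.enorm_eq_ofReal_abs]
      exact ENNReal.ofReal_le_ofReal (abs_label_sub_le j x)
    have hcoord : |a j - b j| ≤ ‖a - b‖ := PiLp.norm_apply_le (a - b) j
    simp only [jump_single, ← mul_sub, enorm_mul]
    rw [lintegral_const_mul' _ _ enorm_ne_top, ENNReal.ofReal_mul d.cast_nonneg]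
    exact mul_le_mul' hlabel ((setLIntegral_le_lintegral _ _).trans
      ((lintegral_enorm_indicator_Ioo_sub_le _ _).trans (ENNReal.ofReal_le_ofReal hcoord)))
  calc _ ≤ ∑ _j : Fin d, ENNReal.ofReal (d * ‖a - b‖) := by
        rw [lintegral_markIntensity hm]
        exact Finset.sum_le_sum fun j _ => haxis j
    _ = ENNReal.ofReal ((d : ℝ) ^ 2 * ‖a - b‖) := by
        rw [Finset.sum_const, Finset.card_univ, Fintype.card_fin, ← ENNReal.ofReal_nsmul,
          nsmul_eq_mul, sq, mul_assoc]

theorem lintegral_enorm_jump_sub_le_const (x y : Fin d) (a b : Vec d) :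
    ∫⁻ ξ, ‖jump x ξ a - jump y ξ b‖ₑ ∂(markIntensity d M)
      ≤ ENNReal.ofReal (2 * (d : ℝ) ^ 3 * M) := by
  have hpoint : ∀ ξ, ‖jump x ξ a - jump y ξ b‖ₑ ≤ ENNReal.ofReal (2 * (d : ℝ) ^ 2) := fun ξ => by
    rw [Real.enorm_eq_ofReal_abs]
    refine ENNReal.ofReal_le_ofReal ((abs_sub _ _).trans ?_)
    linarith [abs_jump_le x ξ a, abs_jump_le y ξ b]
  calc _ ≤ ∫⁻ _ξ, ENNReal.ofReal (2 * (d : ℝ) ^ 2) ∂(markIntensity d M) := lintegral_mono hpoint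
    _ = ENNReal.ofReal (2 * (d : ℝ) ^ 3 * M) := by
        rw [lintegral_const, markIntensity_univ, ← ENNReal.ofReal_mul (by positivity)]
        congr 1
        ring

/-- The rate at which the distance of two coupled players grows, when the rates of the players are
bounded by `M` and `ℓ / N`-close. -/
def couplingRate (d : ℕ) (M ℓ : ℝ) : ℝ := 2 * (d : ℝ) ^ 3 * M + (d : ℝ) ^ 2 * ℓ

theorem couplingRate_nonneg {ℓ : ℝ} (hM : 0 ≤ M) (hℓ : 0 ≤ ℓ) : 0 ≤ couplingRate d M ℓ := by
  unfold couplingRate; positivity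

theorem lintegral_enorm_jump_sub_le_couplingRate {N : ℕ} {ℓ : ℝ} (hM : 0 ≤ M) (hℓ : 0 ≤ ℓ)
    {x y : Fin N → Fin d} {i : Fin N} {a b : Vec d}
    (hab : x i = y i → ‖a - b‖ ≤ ℓ / N * (1 + hammingDist x y)) :
    ∫⁻ ξ, ‖jump (x i) ξ a - jump (y i) ξ b‖ₑ ∂(markIntensity d M)
      ≤ ENNReal.ofReal (couplingRate d M ℓ *
          ((if x i = y i then 0 else 1) + (N : ℝ)⁻¹ * (1 + hammingDist x y))) := by
  have hMd : 0 ≤ 2 * (d : ℝ) ^ 3 * M := by positivity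
  have hℓd : 0 ≤ (d : ℝ) ^ 2 * ℓ := by positivity
  have hh : 0 ≤ (N : ℝ)⁻¹ * (1 + hammingDist x y) := by positivity
  unfold couplingRate
  split_ifs with hxy
  · rw [hxy]
    refine (lintegral_enorm_jump_sub_le (y i) a b).trans (ENNReal.ofReal_le_ofReal ?_)
    calc (d : ℝ) ^ 2 * ‖a - b‖ ≤ (d : ℝ) ^ 2 * (ℓ / N * (1 + hammingDist x y)) := by
          gcongr
          exact hab hxy
      _ = (d : ℝ) ^ 2 * ℓ * ((N : ℝ)⁻¹ * (1 + hammingDist x y)) := by ring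
      _ ≤ _ := by nlinarith
  · refine (lintegral_enorm_jump_sub_le_const (x i) (y i) a b).trans (ENNReal.ofReal_le_ofReal ?_)
    nlinarith

end Jumps

/-! ### Coupling of two systems driven by the same noise -/

theorem measurableSet_markSet (d : ℕ) (M : ℝ) : MeasurableSet (markSet d M) := by
  simp only [markSet, ofPred_forall]
  exact .iInter fun y => measurableSet_Icc.preimage (by fun_prop)

theorem IsCadlag.eventually_eq_leftLim {d : ℕ} {T s : ℝ} {φ : ℝ → Fin d} (h : IsCadlag T φ)
    (hs : s ∈ Ioc 0 T) : ∀ᶠ r in 𝓝[<] s, φ r = Function.leftLim φ s :=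
  (tendsto_leftLim_of_tendsto (h.2 s hs)).eventually
    ((isOpen_discrete {Function.leftLim φ s}).mem_nhds rfl)

/-- The configuration `X_{s-}` of the players just before time `s`. -/
def leftConfig {d N : ℕ} {Ω : Type*} (X : Fin N → ℝ → Ω → Fin d) (s : ℝ) (ω : Ω) : Fin N → Fin d :=
  fun j => Function.leftLim (fun r => X j r ω) s

namespace SolvesSDE

variable {d N : ℕ} {T M : ℝ} {Ω : Type*} {mΩ : MeasurableSpace Ω} {P : Measure Ω}
  {𝓕 : Filtration ℝ mΩ} {𝒩 : Fin N → Ω → Measure (ℝ × Vec d)} {Z : Fin N → Ω → Fin d}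
  {α β : Fin N → ℝ → (Fin N → Fin d) → Vec d} {X Y : Fin N → ℝ → Ω → Fin d}

theorem measurable_config (hX : SolvesSDE T M P 𝓕 𝒩 Z α X) {t : ℝ} (ht : t ∈ Icc 0 T) :
    Measurable[𝓕 t] fun ω j => X j t ω :=
  @measurable_pi_lambda _ _ _ (𝓕 t) _ _ fun j => hX.adapted j t ht

theorem eventually_eq_leftConfig (hX : SolvesSDE T M P 𝓕 𝒩 Z α X) (ω : Ω) {s : ℝ}
    (hs : s ∈ Ioc 0 T) : ∀ᶠ r in 𝓝[<] s, (fun j => X j r ω) = leftConfig X s ω := by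
  filter_upwards [eventually_all.2 fun j => (hX.cadlag j ω).eventually_eq_leftLim hs] with r hr
  exact funext hr

theorem congr_rates (hX : SolvesSDE T M P 𝓕 𝒩 Z α X)
    (hαβ : ∀ i, ∀ t ∈ Icc 0 T, ∀ x, α i t x = β i t x) : SolvesSDE T M P 𝓕 𝒩 Z β X where
  adapted := hX.adapted
  cadlag := hX.cadlag
  equation := by
    filter_upwards [hX.equation] with ω hω i t ht
    refine (hω i t ht).trans (congrArg _ (setIntegral_congr_fun
      (measurableSet_Ioc.prod (measurableSet_markSet d M)) fun p hp => ?_))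
    simp only [hαβ i p.1 ⟨hp.1.1.le, hp.1.2.trans ht.2⟩]

theorem integrableOn_jump (hX : SolvesSDE T M P 𝓕 𝒩 Z α X) (hα : ∀ i x, Measurable (α i · x))
    (i : Fin N) {ω : Ω} (hω : 𝒩 i ω univ < ∞) {t : ℝ} (ht : t ≤ T) :
    IntegrableOn (fun p => jump (leftConfig X p.1 ω i) p.2 (α i p.1 (leftConfig X p.1 ω)))
      (Ioc 0 t ×ˢ markSet d M) (𝒩 i ω) := by
  have : IsFiniteMeasure (𝒩 i ω) := ⟨hω⟩
  refine IntegrableOn.mono_set (t := Ioc 0 t ×ˢ univ) ?_ (prod_mono_right (subset_univ _))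
  exact Integrable.of_bound (aemeasurable_comp_leftLim (φ := fun r j => X j r ω)
    (f := fun x p => jump (x i) p.2 (α i p.1 x))
    (fun s hs => hX.eventually_eq_leftConfig ω ⟨hs.1, hs.2.trans ht⟩)
    (fun x => measurable_jump _ measurable_snd ((hα i x).comp measurable_fst))
    _).aestronglyMeasurable _ (ae_of_all _ fun p => abs_jump_le _ _ _)

theorem enorm_label_sub_le (hY : SolvesSDE T M P 𝓕 𝒩 Z α Y) (hX : SolvesSDE T M P 𝓕 𝒩 Z β X)
    (hα : ∀ i x, Measurable (α i · x)) (hβ : ∀ i x, Measurable (β i · x))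
    {i : Fin N}
    (h𝒩 : ∀ᵐ ω ∂P, 𝒩 i ω univ < ∞) {t : ℝ} (ht : t ≤ T) :
    ∀ᵐ ω ∂P, ∀ r ∈ Icc 0 t, ‖label (Y i r ω) - label (X i r ω)‖ₑ
      ≤ ∫⁻ p in Ioc 0 t ×ˢ univ,
          ‖jump (leftConfig Y p.1 ω i) p.2 (α i p.1 (leftConfig Y p.1 ω))
            - jump (leftConfig X p.1 ω i) p.2 (β i p.1 (leftConfig X p.1 ω))‖ₑ ∂(𝒩 i ω) := by
  filter_upwards [hY.equation, hX.equation, h𝒩] with ω hYω hXω hω r hr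
  have hrT : r ≤ T := hr.2.trans ht
  rw [hYω i r ⟨hr.1, hrT⟩, hXω i r ⟨hr.1, hrT⟩, add_sub_add_left_eq_sub]
  refine (congrArg _ (integral_sub (hY.integrableOn_jump hα i hω hrT)
    (hX.integrableOn_jump hβ i hω hrT)).symm).trans_le ?_
  exact (enorm_integral_le_lintegral_enorm _).trans
    (lintegral_mono_set (prod_mono (Ioc_subset_Ioc_right hr.2) (subset_univ _)))

end SolvesSDE

theorem integral_mismatch_add_hammingDist_le {d N : ℕ} {Ω : Type*} {mΩ : MeasurableSpace Ω}
    {P : Measure Ω} [IsProbabilityMeasure P] {Y X : Ω → Fin N → Fin d} (hY : Measurable Y)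
    (hX : Measurable X) {b : ℝ} (hb : ∀ j, P.real {ω | Y ω j ≠ X ω j} ≤ b) (i : Fin N) :
    ∫ ω, ((if Y ω i = X ω i then 0 else 1) + (N : ℝ)⁻¹ * (1 + hammingDist (Y ω) (X ω))) ∂P
      ≤ 2 * b + (N : ℝ)⁻¹ := by
  have hint : ∀ g : (Fin N → Fin d) × (Fin N → Fin d) → ℝ,
      Integrable (fun ω => g (Y ω, X ω)) P := fun g =>
    (Integrable.of_finite (f := g)).comp_measurable (hY.prodMk hX)
  have hmismatch : ∀ j, ∫ ω, (if Y ω j = X ω j then (0 : ℝ) else 1) ∂P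
      = P.real {ω | Y ω j ≠ X ω j} := fun j => by
    have hmeas : MeasurableSet {ω | Y ω j ≠ X ω j} :=
      (measurableSet_eq_fun ((measurable_pi_apply j).comp hY)
        ((measurable_pi_apply j).comp hX)).compl
    rw [← integral_indicator_one hmeas]
    congr 1 with ω
    simp [indicator, ite_not]
  have hhamming : ∫ ω, (hammingDist (Y ω) (X ω) : ℝ) ∂P ≤ N * b := by
    calc ∫ ω, (hammingDist (Y ω) (X ω) : ℝ) ∂P
        = ∫ ω, ∑ j, (if Y ω j = X ω j then (0 : ℝ) else 1) ∂P := by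
          congr 1 with ω
          simp [hammingDist, Finset.natCast_card_filter, ite_not]
      _ = ∑ j, P.real {ω | Y ω j ≠ X ω j} := by
          rw [integral_finsetSum _ fun j _ => hint fun q => if q.1 j = q.2 j then 0 else 1]
          exact Finset.sum_congr rfl fun j _ => hmismatch j
      _ ≤ N * b := by
          simpa using Finset.sum_le_card_nsmul Finset.univ _ b fun j _ => hb j
  have hN : (0 : ℝ) < N := by exact_mod_cast i.pos
  calc _ = P.real {ω | Y ω i ≠ X ω i}
        + (N : ℝ)⁻¹ * (1 + ∫ ω, (hammingDist (Y ω) (X ω) : ℝ) ∂P) := by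
        rw [integral_add (hint fun q => if q.1 i = q.2 i then 0 else 1)
          (hint fun q => (N : ℝ)⁻¹ * (1 + hammingDist q.1 q.2)), hmismatch, integral_const_mul,
          integral_add (integrable_const _) (hint fun q => hammingDist q.1 q.2)]
        simp
    _ ≤ b + (N : ℝ)⁻¹ * (1 + N * b) := by gcongr; exact hb i
    _ = 2 * b + (N : ℝ)⁻¹ := by field_simp; ring

theorem integral_mul_exp_add_const_le {A m e t T : ℝ} (hA : 0 ≤ A) (hm : 0 ≤ m) (he : 0 ≤ e)
    (ht : t ∈ Icc 0 T) :
    ∫ s in (0 : ℝ)..t, (A * (m * Real.exp (2 * A * s)) + e)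
      ≤ (m / 2 + e * T) * Real.exp (2 * A * t) := by
  have hprim : ∀ s, HasDerivAt (fun s => m / 2 * Real.exp (2 * A * s) + e * s)
      (A * (m * Real.exp (2 * A * s)) + e) s := fun s => by
    refine ((((hasDerivAt_id s).const_mul (2 * A)).exp.const_mul (m / 2)).add
      ((hasDerivAt_id s).const_mul e)).congr_deriv ?_
    simp only [id]
    ring
  have hexp : 1 ≤ Real.exp (2 * A * t) := Real.one_le_exp (mul_nonneg (by positivity) ht.1)
  rw [intervalIntegral.integral_eq_sub_of_hasDerivAt (fun s _ => hprim s)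
    (Continuous.intervalIntegrable (by fun_prop) _ _)]
  calc _ ≤ m / 2 * Real.exp (2 * A * t) + e * t := by
        simp only [mul_zero, Real.exp_zero, add_zero]
        linarith
    _ ≤ m / 2 * Real.exp (2 * A * t) + e * T * Real.exp (2 * A * t) := by
        refine add_le_add le_rfl ?_
        calc e * t ≤ e * T := by gcongr; exact ht.2
          _ ≤ _ := le_mul_of_one_le_right (mul_nonneg he (ht.1.trans ht.2)) hexp
    _ = _ := (add_mul _ _ _).symm

/-- The functions `ψ j` need not be measurable, so instead of integrating them one improves a
majorant `m e^{2At}` to `(m/2 + eT) e^{2At}` and takes the smallest `m`. -/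
theorem le_mul_exp_of_le_integral_majorant {ι : Type*} {ψ : ι → ℝ → ℝ} {A e T : ℝ}
    (hA : 0 ≤ A) (he : 0 ≤ e) (hψ₁ : ∀ j t, ψ j t ≤ 1)
    (hψ : ∀ b : ℝ → ℝ, Continuous b → Monotone b → (∀ j, ∀ s ∈ Icc 0 T, ψ j s ≤ b s) →
      ∀ j, ∀ t ∈ Icc 0 T, ψ j t ≤ ∫ s in (0 : ℝ)..t, (A * b s + e))
    (j : ι) {t : ℝ} (ht : t ∈ Icc 0 T) : ψ j t ≤ 2 * e * T * Real.exp (2 * A * t) := by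
  let Λ : Set ℝ := {m | 0 ≤ m ∧ ∀ j, ∀ s ∈ Icc 0 T, ψ j s ≤ m * Real.exp (2 * A * s)}
  have hΛ : Λ.Nonempty := ⟨1, zero_le_one, fun j s hs => (hψ₁ j s).trans (by
    rw [one_mul]; exact Real.one_le_exp (mul_nonneg (by positivity) hs.1))⟩
  have himprove : ∀ m ∈ Λ, m / 2 + e * T ∈ Λ := fun m ⟨hm, hle⟩ => by
    have hT : 0 ≤ T := ht.1.trans ht.2
    exact ⟨by positivity, fun j s hs =>
      (hψ (fun r => m * Real.exp (2 * A * r)) (by fun_prop) (fun r r' hr => by dsimp only; gcongr)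
        hle j s hs).trans (integral_mul_exp_add_const_le hA hm he hs)⟩
  have hinf : sInf Λ ≤ 2 * e * T := by
    have : 2 * (sInf Λ - e * T) ≤ sInf Λ := le_csInf hΛ fun m hm => by
      linarith [csInf_le ⟨0, fun m hm => hm.1⟩ (himprove m hm)]
    linarith
  calc ψ j t ≤ sInf Λ * Real.exp (2 * A * t) :=
        (div_le_iff₀ (Real.exp_pos _)).1 (le_csInf hΛ fun m hm =>
          (div_le_iff₀ (Real.exp_pos _)).2 (hm.2 j t ht))
    _ ≤ 2 * e * T * Real.exp (2 * A * t) := by gcongr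

/-- The constant `C` in the estimate `E[sup_t |Y_i(t) - X_i(t)|] ≤ C / N`. -/
def couplingConst (d : ℕ) (T M ℓ : ℝ) : ℝ :=
  couplingRate d M ℓ * T *
    (4 * couplingRate d M ℓ * T * Real.exp (4 * couplingRate d M ℓ * T) + 1)

theorem couplingConst_nonneg {d : ℕ} {T M ℓ : ℝ} (hT : 0 ≤ T) (hM : 0 ≤ M) (hℓ : 0 ≤ ℓ) :
    0 ≤ couplingConst d T M ℓ := by
  have hk := couplingRate_nonneg (d := d) hM hℓ
  unfold couplingConst
  positivity

section Coupling

variable {d N : ℕ} {T M ℓ : ℝ} {Ω : Type*} {mΩ : MeasurableSpace Ω} {P : Measure Ω}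
  [IsProbabilityMeasure P] {𝓕 : Filtration ℝ mΩ} {𝒩 : Fin N → Ω → Measure (ℝ × Vec d)}
  {Z : Fin N → Ω → Fin d} {α β : Fin N → ℝ → (Fin N → Fin d) → Vec d} {X Y : Fin N → ℝ → Ω → Fin d}

theorem lintegral_enorm_jump_config_sub_le (hM : 0 ≤ M) (hℓ : 0 ≤ ℓ)
    {Y X : Ω → Fin N → Fin d} (hY : Measurable Y) (hX : Measurable X) {i : Fin N}
    {a a' : (Fin N → Fin d) → Vec d}
    (ha : ∀ x y, x i = y i → ‖a x - a' y‖ ≤ ℓ / N * (1 + hammingDist x y)) {b : ℝ}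
    (hb : ∀ j, P.real {ω | Y ω j ≠ X ω j} ≤ b) :
    ∫⁻ ω, ∫⁻ ξ, ‖jump (Y ω i) ξ (a (Y ω)) - jump (X ω i) ξ (a' (X ω))‖ₑ ∂(markIntensity d M) ∂P
      ≤ ENNReal.ofReal (couplingRate d M ℓ * (2 * b + (N : ℝ)⁻¹)) := by
  have hk := couplingRate_nonneg (d := d) hM hℓ
  let w : (Fin N → Fin d) × (Fin N → Fin d) → ℝ := fun q =>
    (if q.1 i = q.2 i then 0 else 1) + (N : ℝ)⁻¹ * (1 + hammingDist q.1 q.2)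
  have hw : ∀ q, 0 ≤ w q := fun q => by simp only [w]; split_ifs <;> positivity
  have hint : Integrable (fun ω => couplingRate d M ℓ * w (Y ω, X ω)) P :=
    ((Integrable.of_finite (f := w)).comp_measurable (hY.prodMk hX)).const_mul _
  calc _ ≤ ∫⁻ ω, ENNReal.ofReal (couplingRate d M ℓ * w (Y ω, X ω)) ∂P :=
        lintegral_mono fun ω => lintegral_enorm_jump_sub_le_couplingRate hM hℓ (ha _ _)
    _ = ENNReal.ofReal (couplingRate d M ℓ * ∫ ω, w (Y ω, X ω) ∂P) := by
        rw [← ofReal_integral_eq_lintegral_ofReal hint (ae_of_all _ fun ω => mul_nonneg hk (hw _)),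
          integral_const_mul]
    _ ≤ _ := by gcongr; exact integral_mismatch_add_hammingDist_le hY hX hb i

namespace SolvesSDE

theorem upperIntegralLE_of_mismatch_le (hY : SolvesSDE T M P 𝓕 𝒩 Z α Y)
    (hX : SolvesSDE T M P 𝓕 𝒩 Z β X)
    {i : Fin N} (h𝒩 : IsForwardNoise P 𝓕 T (noiseIntensity d T M) (𝒩 i))
    (hα : ∀ i x, Measurable (α i · x)) (hβ : ∀ i x, Measurable (β i · x)) (hM : 0 ≤ M)
    (hℓ : 0 ≤ ℓ) (hαβ : ∀ t ∈ Icc 0 T, ∀ i x y, x i = y i →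
      ‖α i t x - β i t y‖ ≤ ℓ / N * (1 + hammingDist x y))
    {b : ℝ → ℝ} (hbm : Monotone b)
    (hb : ∀ j, ∀ s ∈ Icc 0 T, P.real {ω | Y j s ω ≠ X j s ω} ≤ b s) {t : ℝ}
    (ht : t ≤ T) :
    UpperIntegralLE P (fun ω => ⨆ r ∈ Icc 0 t, ‖label (Y i r ω) - label (X i r ω)‖ₑ)
      (∫⁻ s in Ioc 0 t, ENNReal.ofReal (couplingRate d M ℓ * (2 * b s + (N : ℝ)⁻¹))) := by
  have hbound := h𝒩.upperIntegralLE_setLIntegral_leftLim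
    (Z := fun s ω => (fun j => Y j s ω, fun j => X j s ω))
    (Zl := fun s ω => (leftConfig Y s ω, leftConfig X s ω))
    (f := fun c p => ‖jump (c.1 i) p.2 (α i p.1 c.1) - jump (c.2 i) p.2 (β i p.1 c.2)‖ₑ)
    (b := fun s => ENNReal.ofReal (couplingRate d M ℓ * (2 * b s + (N : ℝ)⁻¹)))
    (fun s hs => (hY.measurable_config hs).prodMk (hX.measurable_config hs))
    (fun ω s hs => ((hY.eventually_eq_leftConfig ω hs).and
      (hX.eventually_eq_leftConfig ω hs)).mono fun r h => Prod.ext h.1 h.2)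
    (fun c => ((measurable_jump _ measurable_snd ((hα i c.1).comp measurable_fst)).sub
      (measurable_jump _ measurable_snd ((hβ i c.2).comp measurable_fst))).enorm) ht
    fun r s hr hrs hst => by
      have hrT : r ∈ Icc 0 T := ⟨hr, hrs.le.trans (hst.trans ht)⟩
      have hsT : s ∈ Icc 0 T := ⟨hr.trans hrs.le, hst.trans ht⟩
      exact lintegral_enorm_jump_config_sub_le hM hℓ
        ((hY.measurable_config hrT).mono (𝓕.le r) le_rfl)
        ((hX.measurable_config hrT).mono (𝓕.le r) le_rfl) (hαβ s hsT i)
        fun j => (hb j r hrT).trans (hbm hrs.le)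
  refine hbound.mono ?_ le_rfl
  filter_upwards [hY.enorm_label_sub_le hX hα hβ h𝒩.ae_lt_top ht] with ω hω
  exact iSup₂_le hω

theorem measureReal_mismatch_le (hY : SolvesSDE T M P 𝓕 𝒩 Z α Y) (hX : SolvesSDE T M P 𝓕 𝒩 Z β X)
    (h𝒩 : ∀ i, IsForwardNoise P 𝓕 T (noiseIntensity d T M) (𝒩 i))
    (hα : ∀ i x, Measurable (α i · x)) (hβ : ∀ i x, Measurable (β i · x)) (hM : 0 ≤ M)
    (hℓ : 0 ≤ ℓ) (hαβ : ∀ t ∈ Icc 0 T, ∀ i x y, x i = y i →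
      ‖α i t x - β i t y‖ ≤ ℓ / N * (1 + hammingDist x y)) (i : Fin N) {t : ℝ}
    (ht : t ∈ Icc 0 T) :
    P.real {ω | Y i t ω ≠ X i t ω} ≤ 2 * (couplingRate d M ℓ * (N : ℝ)⁻¹) * T
      * Real.exp (2 * (2 * couplingRate d M ℓ) * t) := by
  have hk := couplingRate_nonneg (d := d) hM hℓ
  refine le_mul_exp_of_le_integral_majorant (ψ := fun j t => P.real {ω | Y j t ω ≠ X j t ω})
    (by positivity) (by positivity) (fun _ _ => measureReal_le_one)
    (fun b hbc hbm hb j t ht => ?_) i ht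
  have hbound := (hY.upperIntegralLE_of_mismatch_le hX (h𝒩 j) hα hβ hM hℓ hαβ hbm hb
    ht.2).lintegral_le
  have hpos : ∀ s ∈ Ioc 0 t, 0 ≤ couplingRate d M ℓ * (2 * b s + (N : ℝ)⁻¹) := fun s hs => by
    have := measureReal_nonneg.trans (hb j s ⟨hs.1.le, hs.2.trans ht.2⟩)
    positivity
  have hmarkov : P {ω | Y j t ω ≠ X j t ω}
      ≤ ∫⁻ ω, ⨆ r ∈ Icc 0 t, ‖label (Y j r ω) - label (X j r ω)‖ₑ ∂P := by
    have hmeas : MeasurableSet {ω | Y j t ω ≠ X j t ω} :=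
      (measurableSet_eq_fun ((hY.adapted j t ht).mono (𝓕.le t) le_rfl)
        ((hX.adapted j t ht).mono (𝓕.le t) le_rfl)).compl
    rw [← lintegral_indicator_one hmeas]
    refine lintegral_mono (indicator_le fun ω hω => ?_)
    refine le_trans ?_ (le_iSup₂_of_le t (right_mem_Icc.2 ht.1) le_rfl)
    rw [Real.enorm_eq_ofReal_abs]
    exact ENNReal.one_le_ofReal.2 (one_le_abs_label_sub hω)
  have hint : ∫⁻ s in Ioc 0 t, ENNReal.ofReal (couplingRate d M ℓ * (2 * b s + (N : ℝ)⁻¹))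
      = ENNReal.ofReal (∫ s in (0 : ℝ)..t, (2 * couplingRate d M ℓ * b s
        + couplingRate d M ℓ * (N : ℝ)⁻¹)) := by
    rw [← ofReal_integral_eq_lintegral_ofReal
      (Continuous.integrableOn_Ioc (by fun_prop))
      ((ae_restrict_mem measurableSet_Ioc).mono hpos), intervalIntegral.integral_of_le ht.1]
    congr 2 with s
    ring
  have hnonneg : 0 ≤ ∫ s in (0 : ℝ)..t, (2 * couplingRate d M ℓ * b s
      + couplingRate d M ℓ * (N : ℝ)⁻¹) :=
    intervalIntegral.integral_nonneg ht.1 fun s hs => by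
      have := measureReal_nonneg.trans (hb j s ⟨hs.1, hs.2.trans ht.2⟩)
      positivity
  exact ENNReal.toReal_le_of_le_ofReal hnonneg (hmarkov.trans (hbound.trans_eq hint))

theorem upperIntegralLE_iSup_enorm_label_sub (hY : SolvesSDE T M P 𝓕 𝒩 Z α Y)
    (hX : SolvesSDE T M P 𝓕 𝒩 Z β X)
    (h𝒩 : ∀ i, IsForwardNoise P 𝓕 T (noiseIntensity d T M) (𝒩 i))
    (hα : ∀ i x, ContinuousOn (α i · x) (Icc 0 T)) (hβ : ∀ i x, ContinuousOn (β i · x) (Icc 0 T))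
    (hT : 0 ≤ T) (hM : 0 ≤ M) (hℓ : 0 ≤ ℓ) (hαβ : ∀ t ∈ Icc 0 T, ∀ i x y, x i = y i →
      ‖α i t x - β i t y‖ ≤ ℓ / N * (1 + hammingDist x y)) (i : Fin N) :
    UpperIntegralLE P (fun ω => ⨆ t ∈ Icc 0 T, ‖label (Y i t ω) - label (X i t ω)‖ₑ)
      (ENNReal.ofReal (couplingConst d T M ℓ / N)) := by
  wlog hmeas : (∀ i x, Measurable (α i · x)) ∧ ∀ i x, Measurable (β i · x) generalizing α β
  · have hclamp : ∀ {γ : Fin N → ℝ → (Fin N → Fin d) → Vec d},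
        (∀ i x, ContinuousOn (γ i · x) (Icc 0 T)) →
          ∀ i x, Continuous fun t => γ i (projIcc 0 T hT t) x := fun hγ i x =>
      (hγ i x).comp_continuous (by fun_prop) fun t => (projIcc 0 T hT t).2
    have hproj : ∀ {γ : Fin N → ℝ → (Fin N → Fin d) → Vec d}, ∀ i, ∀ t ∈ Icc 0 T, ∀ x,
        γ i t x = γ i (projIcc 0 T hT t) x := fun i t ht x => by rw [projIcc_of_mem hT ht]
    exact this (hY.congr_rates hproj) (hX.congr_rates hproj)
      (fun i x => (hclamp hα i x).continuousOn)
      (fun i x => (hclamp hβ i x).continuousOn) (fun t _ => hαβ _ (projIcc 0 T hT t).2)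
      ⟨fun i x => (hclamp hα i x).measurable, fun i x => (hclamp hβ i x).measurable⟩
  have hk := couplingRate_nonneg (d := d) hM hℓ
  set k := couplingRate d M ℓ with hkdef
  refine (hY.upperIntegralLE_of_mismatch_le hX (h𝒩 i) hmeas.1 hmeas.2 hM hℓ hαβ
    (monotone_const (c := 2 * (k * (N : ℝ)⁻¹) * T * Real.exp (2 * (2 * k) * T)))
    (fun j s hs => (hY.measureReal_mismatch_le hX h𝒩 hmeas.1 hmeas.2 hM hℓ hαβ j hs).trans ?_)
    le_rfl).mono EventuallyLE.rfl ?_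
  · have := hs.2
    gcongr
  · rw [setLIntegral_const, Real.volume_Ioc, ← ENNReal.ofReal_mul (by positivity)]
    refine ENNReal.ofReal_le_ofReal (le_of_eq ?_)
    rw [couplingConst, ← hkdef, sub_zero]
    ring_nf

end SolvesSDE

end Coupling

/-! ### Passage to the estimates -/

variable {d N : ℕ}

theorem IsPlayerNoise.isForwardNoise {T M : ℝ} {Ω : Type*} {mΩ : MeasurableSpace Ω}
    {P : Measure Ω} {𝓕 : Filtration ℝ mΩ} {𝒩 : Fin N → Ω → Measure (ℝ × Vec d)}
    (h : IsPlayerNoise T M P 𝓕 𝒩) (i : Fin N) :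
    IsForwardNoise P 𝓕 T (noiseIntensity d T M) (𝒩 i) where
  measurable := (h.poisson i).measurable
  bind_eq := (h.poisson i).bind_eq
  indep_future s hs := indep_of_indep_of_le_right (h.indep_future s hs) (le_iSup (fun i =>
    MeasurableSpace.comap (fun ω => (𝒩 i ω).restrict (Ioi s ×ˢ univ)) inferInstance) i)

theorem Game.H1.continuousOn_feedback {𝒢 : Game d} {K : ℝ} (hH1 : 𝒢.H1 K)
    {w : Fin N → ℝ → (Fin N → Fin d) → ℝ} {s : Set ℝ} {i : Fin N}
    (hw : ∀ x, ContinuousOn (w i · x) s) (hwK : ∀ t ∈ s, ∀ x, ‖playerDiff i (w i t) x‖ ≤ K)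
    (x : Fin N → Fin d) : ContinuousOn (𝒢.feedback w i · x) s := by
  obtain ⟨_, -, hα⟩ := hH1 (x i)
  exact hα.continuousOn.comp ((PiLp.continuous_toLp 2 _).comp_continuousOn
    (continuousOn_pi.2 fun z => (hw (Function.update x i z)).sub (hw x)))
    fun t ht => mem_closedBall_zero_iff.2 (hwK t ht x)

theorem average_le_of_forall_le {f : Fin N → ℝ} {a : ℝ} (ha : 0 ≤ a) (h : ∀ i, f i ≤ a) :
    (1 / N : ℝ) * ∑ i, f i ≤ a :=
  calc (1 / N : ℝ) * ∑ i, f i ≤ (1 / N : ℝ) * (N * a) := by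
        gcongr
        simpa using Finset.sum_le_card_nsmul Finset.univ f a fun i _ => h i
    _ = N / N * a := by ring
    _ ≤ a := mul_le_of_le_one_left ha (div_self_le_one _)

theorem enorm_diracVec_sub_le (x y : Fin d) :
    ‖diracVec x - diracVec y‖ₑ ≤ 2 * ‖label x - label y‖ₑ := by
  rcases eq_or_ne x y with rfl | hxy
  · simp
  · calc ‖diracVec x - diracVec y‖ₑ ≤ ENNReal.ofReal (2 * |label x - label y|) := by
          rw [← ofReal_norm]
          exact ENNReal.ofReal_le_ofReal
            (by linarith [norm_diracVec_sub_le x y, one_le_abs_label_sub hxy])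
      _ = 2 * ‖label x - label y‖ₑ := by
          rw [ENNReal.ofReal_mul zero_le_two, ENNReal.ofReal_ofNat, Real.enorm_eq_ofReal_abs]

theorem enorm_empirical_sub_le (x y : Fin N → Fin d) :
    ‖empirical x - empirical y‖ₑ ≤ ∑ j, 2 * ‖(N : ℝ)⁻¹‖ₑ * ‖label (x j) - label (y j)‖ₑ := by
  rw [empirical, empirical, ← smul_sub, ← Finset.sum_sub_distrib, enorm_smul]
  calc _ ≤ ‖(N : ℝ)⁻¹‖ₑ * ∑ j, 2 * ‖label (x j) - label (y j)‖ₑ := by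
        gcongr
        exact (enorm_sum_le _ _).trans
          (Finset.sum_le_sum fun j _ => enorm_diracVec_sub_le _ _)
    _ = _ := by
        rw [Finset.mul_sum]
        exact Finset.sum_congr rfl fun j _ => by ring

theorem UpperIntegralLE.iSup_enorm_empirical_sub {Ω : Type*} {mΩ : MeasurableSpace Ω}
    {P : Measure Ω} {s : Set ℝ} {Y X : Fin N → ℝ → Ω → Fin d} {r : ℝ≥0∞}
    (h : ∀ i, UpperIntegralLE P (fun ω => ⨆ t ∈ s, ‖label (Y i t ω) - label (X i t ω)‖ₑ) r) :
    UpperIntegralLE P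
      (fun ω => ⨆ t ∈ s, ‖empirical (fun j => Y j t ω) - empirical (fun j => X j t ω)‖ₑ)
      (2 * r) := by
  refine (UpperIntegralLE.sum (I := Finset.univ) fun i _ =>
    (h i).const_mul (2 * ‖(N : ℝ)⁻¹‖ₑ)).mono (ae_of_all _ fun ω => iSup₂_le fun t ht => ?_) ?_
  · refine (enorm_empirical_sub_le _ _).trans (Finset.sum_le_sum fun j _ => ?_)
    gcongr
    exact le_iSup₂ (f := fun t _ => ‖label (Y j t ω) - label (X j t ω)‖ₑ) t ht
  · have hN : (N : ℝ≥0∞) * ‖(N : ℝ)⁻¹‖ₑ ≤ 1 := by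
      rw [← Real.enorm_natCast, ← enorm_mul, ← ofReal_norm,
        Real.norm_of_nonneg (by positivity)]
      exact ENNReal.ofReal_le_one.2 mul_inv_le_one
    calc ∑ _i : Fin N, 2 * ‖(N : ℝ)⁻¹‖ₑ * r = (N * ‖(N : ℝ)⁻¹‖ₑ) * (2 * r) := by
          rw [Finset.sum_const, Finset.card_univ, Fintype.card_fin, nsmul_eq_mul]; ring
      _ ≤ 2 * r := mul_le_of_le_one_left' hN

theorem iSup_sq_add_lintegral_sq_playerDiff_le {f g : ℝ → (Fin N → Fin d) → ℝ} {T δ : ℝ}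
    (hT : 0 ≤ T) (hfg : ∀ t ∈ Icc 0 T, ∀ x, |f t x - g t x| ≤ δ) (j : Fin N)
    (x : ℝ → Fin N → Fin d) :
    (⨆ t ∈ Icc 0 T, ENNReal.ofReal (|f t (x t) - g t (x t)| ^ 2))
        + ∫⁻ t in Icc 0 T,
          ENNReal.ofReal (‖playerDiff j (f t) (x t) - playerDiff j (g t) (x t)‖ ^ 2)
      ≤ ENNReal.ofReal ((1 + 4 * d * T) * δ ^ 2) := by
  have hdiff : ∀ t ∈ Icc 0 T,
      ‖playerDiff j (f t) (x t) - playerDiff j (g t) (x t)‖ ^ 2 ≤ 4 * d * δ ^ 2 := fun t ht =>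
    calc _ ≤ (√d * (2 * δ)) ^ 2 := by
          rw [← playerDiff_sub]
          exact pow_le_pow_left₀ (norm_nonneg _) (norm_playerDiff_le (hfg t ht) j _) 2
      _ = 4 * d * δ ^ 2 := by rw [mul_pow, Real.sq_sqrt d.cast_nonneg]; ring
  calc _ ≤ ENNReal.ofReal (δ ^ 2) + ∫⁻ _ in Icc 0 T, ENNReal.ofReal (4 * d * δ ^ 2) :=
        add_le_add
          (iSup₂_le fun t ht => ENNReal.ofReal_le_ofReal
            (pow_le_pow_left₀ (abs_nonneg _) (hfg t ht _) 2))
          (setLIntegral_mono' measurableSet_Icc fun t ht =>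
            ENNReal.ofReal_le_ofReal (hdiff t ht))
    _ = _ := by
        rw [setLIntegral_const, Real.volume_Icc, sub_zero, ← ENNReal.ofReal_mul (by positivity),
          ← ENNReal.ofReal_add (by positivity) (by positivity)]
        ring_nf

namespace Game

variable {𝒢 : Game d} {K : ℝ} {U : ℝ → Fin d → Vec d → ℝ}

theorem exists_upperIntegralLE_iSup_enorm_label_sub (hK : 𝒢.IsAprioriRadius K) (hH1 : 𝒢.H1 K)
    (hU : 𝒢.IsRegularSolution U) : ∃ c : ℝ, 0 ≤ c ∧ ∀ N : ℕ, 2 ≤ N →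
      ∀ v : Fin N → ℝ → (Fin N → Fin d) → ℝ, 𝒢.SolvesHJB v →
      ∀ {Ω : Type*} {mΩ : MeasurableSpace Ω} {P : Measure Ω} [IsProbabilityMeasure P]
        {𝓕 : Filtration ℝ mΩ} {𝒩 : Fin N → Ω → Measure (ℝ × Vec d)},
        (∀ i, IsForwardNoise P 𝓕 𝒢.T (noiseIntensity d 𝒢.T 𝒢.M) (𝒩 i)) →
      ∀ {Z : Fin N → Ω → Fin d} {Y X : Fin N → ℝ → Ω → Fin d},
        SolvesSDE 𝒢.T 𝒢.M P 𝓕 𝒩 Z (𝒢.feedback v) Y →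
        SolvesSDE 𝒢.T 𝒢.M P 𝓕 𝒩 Z (𝒢.feedback (projection N U)) X →
        ∀ i, UpperIntegralLE P
          (fun ω => ⨆ t ∈ Icc 0 𝒢.T, ‖label (Y i t ω) - label (X i t ω)‖ₑ)
          (ENNReal.ofReal (c / N)) := by
  obtain ⟨ℓ, hℓ, hfeedback⟩ := exists_norm_feedback_sub_le hK hH1 hU
  obtain ⟨D, hD, -⟩ := hU.exists_hasTransferExpansion
  refine ⟨couplingConst d 𝒢.T 𝒢.M ℓ, couplingConst_nonneg 𝒢.T_pos.le 𝒢.M_pos.le hℓ, ?_⟩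
  intro N hN v hv Ω mΩ P _ 𝓕 𝒩 h𝒩 Z Y X hY hX
  refine hY.upperIntegralLE_iSup_enorm_label_sub hX h𝒩 (fun i => ?_) (fun i => ?_)
    𝒢.T_pos.le 𝒢.M_pos.le hℓ (hfeedback N hN v hv)
  · exact hH1.continuousOn_feedback (fun x => (hv.contDiffOn_time i x).continuousOn)
      fun t ht x => hv.norm_playerDiff_le hN hK i i ht x
  · exact hH1.continuousOn_feedback
      (fun x => (hD.contDiffOn_time (x i) _ (empiricalExcept_mem_simplex hN i x)).continuousOn)
      fun t ht x => hD.norm_playerDiff_projection_self_le hK hN i ht x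

end Game

end FiniteMFG

end

open FiniteMFG in
theorem theorem3p3_general {d : ℕ} (𝒢 : Game d) (K : ℝ) (hK : 𝒢.IsAprioriRadius K)
    (hH1 : 𝒢.H1 K) (U : ℝ → Fin d → Vec d → ℝ) (hU : 𝒢.IsRegularSolution U) :
    ∃ C : ℝ, 0 < C ∧ ∀ (N : ℕ), 2 ≤ N →
      ∀ (v : Fin N → ℝ → (Fin N → Fin d) → ℝ), 𝒢.SolvesHJB v →
      ∀ (Ω : Type*) (mΩ : MeasurableSpace Ω) (P : Measure Ω) (_ : IsProbabilityMeasure P)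
        (𝓕 : Filtration ℝ mΩ) (𝒩 : Fin N → Ω → Measure (ℝ × Vec d)),
        (∀ i, IsForwardNoise P 𝓕 𝒢.T (noiseIntensity d 𝒢.T 𝒢.M) (𝒩 i)) →
      ∀ (Z : Fin N → Ω → Fin d) (Y X : Fin N → ℝ → Ω → Fin d),
        SolvesSDE 𝒢.T 𝒢.M P 𝓕 𝒩 Z (𝒢.feedback v) Y →
        SolvesSDE 𝒢.T 𝒢.M P 𝓕 𝒩 Z (𝒢.feedback (projection N U)) X →
        (∀ i, ∫⁻ ω, ⨆ t ∈ Icc 0 𝒢.T,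
            ENNReal.ofReal |label (Y i t ω) - label (X i t ω)| ∂P
          ≤ ENNReal.ofReal (C / N)) ∧
        (∫⁻ ω, ⨆ t ∈ Icc 0 𝒢.T,
            ENNReal.ofReal ‖empirical (fun j => Y j t ω) - empirical (fun j => X j t ω)‖ ∂P
          ≤ ENNReal.ofReal (C / N)) ∧
        (∀ i, ∫⁻ ω, ((⨆ t ∈ Icc 0 𝒢.T,
              ENNReal.ofReal (|projection N U i t (fun j => Y j t ω)
                - v i t (fun j => Y j t ω)| ^ 2))
            + ∫⁻ t in Icc 0 𝒢.T,
              ENNReal.ofReal (‖playerDiff i (projection N U i t) (fun j => Y j t ω)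
                - playerDiff i (v i t) (fun j => Y j t ω)‖ ^ 2)) ∂P
          ≤ ENNReal.ofReal (C / N ^ 2)) ∧
        (∀ᵐ ω ∂P, (1 / N : ℝ) * ∑ i, |v i 0 (fun j => Z j ω)
            - projection N U i 0 (fun j => Z j ω)| ≤ C / N) := by
  obtain ⟨c, hc, hclose⟩ := Game.exists_abs_projection_sub_le hK hH1 hU
  obtain ⟨c', hc', hpath⟩ := Game.exists_upperIntegralLE_iSup_enorm_label_sub hK hH1 hU
  have hT := 𝒢.T_pos
  have hsq : 0 ≤ (1 + 4 * d * 𝒢.T) * c ^ 2 := by positivity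
  refine ⟨1 + 2 * c' + (1 + 4 * d * 𝒢.T) * c ^ 2 + c, by positivity, ?_⟩
  intro N hN v hv Ω mΩ P _ 𝓕 𝒩 h𝒩 Z Y X hY hX
  have hlabel := hpath N hN v hv h𝒩 hY hX
  simp only [← Real.enorm_eq_ofReal_abs, ofReal_norm]
  refine ⟨fun i => (hlabel i).lintegral_le.trans ?_,
    (UpperIntegralLE.iSup_enorm_empirical_sub hlabel).lintegral_le.trans ?_,
    fun i => (lintegral_mono fun ω => iSup_sq_add_lintegral_sq_playerDiff_le hT.le
      (hclose N hN v hv · · i) i (fun t j => Y j t ω)).trans ?_,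
    ae_of_all _ fun ω => ?_⟩
  · gcongr; linarith
  · rw [← ENNReal.ofReal_ofNat, ← ENNReal.ofReal_mul zero_le_two, mul_div_assoc']
    gcongr; linarith
  · rw [lintegral_const, measure_univ, mul_one, div_pow, mul_div_assoc']
    gcongr; linarith
  · refine (average_le_of_forall_le (by positivity) fun i => ?_).trans (?_ : c / N ≤ _)
    · rw [abs_sub_comm]
      exact hclose N hN v hv 0 (left_mem_Icc.2 hT.le) i _
    · gcongr; linarith

open FiniteMFG in
theorem theorem3p3 {d : ℕ} (𝒢 : Game d) (K : ℝ) (hK : 𝒢.IsAprioriRadius K) (hH1 : 𝒢.H1 K)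
    (U : ℝ → Fin d → Vec d → ℝ) (hU : 𝒢.IsRegularSolution U) :
    ∃ C : ℝ, 0 < C ∧ ∀ (N : ℕ), 2 ≤ N →
      ∀ (v : Fin N → ℝ → (Fin N → Fin d) → ℝ), 𝒢.SolvesHJB v →
      ∀ (Ω : Type*) (mΩ : MeasurableSpace Ω) (P : Measure Ω) (_ : IsProbabilityMeasure P)
        (𝓕 : Filtration ℝ mΩ) (𝒩 : Fin N → Ω → Measure (ℝ × Vec d)),
        IsPlayerNoise 𝒢.T 𝒢.M P 𝓕 𝒩 →
      ∀ (m₀ : Vec d), m₀ ∈ simplex d →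
      ∀ (Z : Fin N → Ω → Fin d), IsInitialDatum P 𝓕 m₀ Z →
      ∀ (Y X : Fin N → ℝ → Ω → Fin d),
        SolvesSDE 𝒢.T 𝒢.M P 𝓕 𝒩 Z (𝒢.feedback v) Y →
        SolvesSDE 𝒢.T 𝒢.M P 𝓕 𝒩 Z (𝒢.feedback (projection N U)) X →
        (∀ i, ∫⁻ ω, ⨆ t ∈ Icc 0 𝒢.T,
            ENNReal.ofReal |label (Y i t ω) - label (X i t ω)| ∂P
          ≤ ENNReal.ofReal (C / N)) ∧
        (∫⁻ ω, ⨆ t ∈ Icc 0 𝒢.T,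
            ENNReal.ofReal ‖empirical (fun j => Y j t ω) - empirical (fun j => X j t ω)‖ ∂P
          ≤ ENNReal.ofReal (C / N)) ∧
        (∀ i, ∫⁻ ω, ((⨆ t ∈ Icc 0 𝒢.T,
              ENNReal.ofReal (|projection N U i t (fun j => Y j t ω)
                - v i t (fun j => Y j t ω)| ^ 2))
            + ∫⁻ t in Icc 0 𝒢.T,
              ENNReal.ofReal (‖playerDiff i (projection N U i t) (fun j => Y j t ω)
                - playerDiff i (v i t) (fun j => Y j t ω)‖ ^ 2)) ∂P
          ≤ ENNReal.ofReal (C / N ^ 2)) ∧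
        (∀ᵐ ω ∂P, (1 / N : ℝ) * ∑ i, |v i 0 (fun j => Z j ω)
            - projection N U i 0 (fun j => Z j ω)| ≤ C / N) := by
  obtain ⟨C, hC, h⟩ := theorem3p3_general 𝒢 K hK hH1 U hU
  exact ⟨C, hC, fun N hN v hv Ω mΩ P hP 𝓕 𝒩 h𝒩 _ _ Z _ =>
    h N hN v hv Ω mΩ P hP 𝓕 𝒩 h𝒩.isForwardNoise Z⟩
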